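/- Let $\{\xi(n)\}_{n\in\mathbb Z}$ and $\{\eta(m)\}_{m\in\mathbb Z}$ be independent random signs, each equal to $+1$ or $-1$ with probability $1/2$. The corner percolation graph $G=G(\xi,\eta)$ is the following random subgraph of the square lattice $\mathbb Z^2$: the edge $\{(n,k),(n,k+1)\}$ is kept if and only if either $\xi(n)=+1$ and $k$ is even, or $\xi(n)=-1$ and $k$ is odd; the edge $\{(k,m),(k+1,m)\}$ is kept if and only if either $\eta(m)=+1$ and $k$ is even, or $\eta(m)=-1$ and $k$ is odd. Every vertex of $G$ has degree $2$. Colour the unit face of $\mathbb Z^2$ centred at $(n+\frac12,m+\frac12)$ black if $n+m$ is even and white if $n+m$ is odd. The height function $H$ of $G$ is the integer-valued function on the faces that is $0$ at the face centred at $(\frac12,\frac12)$, does not change when one passes to an adjacent face through an edge that is not in $G$, increases by $1$ when one crosses an edge of $G$ from its black side to its white side, and decreases by $1$ when one crosses an edge of $G$ from its white side to its black side. A component of $G$ is on level $\ell\in\mathbb Z$ if all black faces that have one of its edges on their boundary have height $\ell$. A cycle encloses a vertex $v$ if $v$ is not on the cycle and lies in a bounded component of the complement of the cycle in the plane. The diameter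 of a component is its Euclidean diameter as a subset of the plane. **Theorem 1.1.** 1. Almost surely, $G$ has no infinite components (so the component of the origin is almost surely a finite cycle). 2. Almost surely, for every vertex $v\in\mathbb Z^2$ and every level $\ell\in\mathbb Z$, there are infinitely many cycles of $G$ on level $\ell$ that enclose $v$. In particular, every vertex is enclosed by infinitely many cycles. 3. There is an absolute constant $c>0$ such that, for all integers $n\ge 1$, $$\mathbb P(\text{the diameter of the component of the origin is} > n)\ \ge\ c\,n^{-1/2}.$$ 4. The expected diameter of the component of the origin is infinite. -/

import Mathlib

open MeasureTheory ProbabilityTheory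
open scoped ENNReal

namespace CornerPercolation

/-- The corner percolation graph `G(ξ, η)` on the vertex set `ℤ²`.  On the vertical line
`{n} × ℤ` the edges `{(n, k), (n, k + 1)}` with `k` even are kept if `ξ n = 1`, and those with `k`
odd are kept if `ξ n = -1`; on the horizontal line `ℤ × {m}` the edges `{(k, m), (k + 1, m)}` are
treated in the same way, according to the sign `η m`. -/
def graph (ξ η : ℤ → ℤˣ) : SimpleGraph (ℤ × ℤ) :=
  SimpleGraph.fromRel fun u v =>
    (v = (u.1, u.2 + 1) ∧ ((ξ u.1 = 1 ∧ Even u.2) ∨ (ξ u.1 = -1 ∧ Odd u.2))) ∨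
    (v = (u.1 + 1, u.2) ∧ ((η u.2 = 1 ∧ Even u.1) ∨ (η u.2 = -1 ∧ Odd u.1)))

/-- The lattice point `v`, seen as a point of the Euclidean plane. -/
noncomputable def toPlane (v : ℤ × ℤ) : EuclideanSpace ℝ (Fin 2) := !₂[(v.1 : ℝ), (v.2 : ℝ)]

/-- A face of `ℤ²` is given by its lower left corner: `(n, m)` stands for the unit square with
centre `(n + 1/2, m + 1/2)`.  It is black if `n + m` is even, and white otherwise. -/
def IsBlack (f : ℤ × ℤ) : Prop := Even (f.1 + f.2)

open Classical in
/-- The increment of the height on passing from the face `f` to an adjacent face through the edge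
between `u` and `v`: nothing happens if this edge is absent; if it is present, then we gain `1` on
crossing it from its black side to its white side, and lose `1` in the other direction. -/
noncomputable def increment (G : SimpleGraph (ℤ × ℤ)) (f u v : ℤ × ℤ) : ℤ :=
  if G.Adj u v then (if IsBlack f then 1 else -1) else 0

/-- `H` is the height function of the graph `G`: it vanishes on the face with centre `(1/2, 1/2)`,
and along any path of faces it changes by the increments of the steps. (It suffices to prescribe
the steps to the right and upwards: a reversed step swaps the colours, hence the sign.) -/
structure IsHeightFunction (G : SimpleGraph (ℤ × ℤ)) (H : ℤ × ℤ → ℤ) : Prop where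
  origin : H (0, 0) = 0
  right : ∀ n m : ℤ, H (n + 1, m) = H (n, m) + increment G (n, m) (n + 1, m) (n + 1, m + 1)
  up : ∀ n m : ℤ, H (n, m + 1) = H (n, m) + increment G (n, m) (n, m + 1) (n + 1, m + 1)

variable {G : SimpleGraph (ℤ × ℤ)}

/-- The component `C` is a (finite) cycle. -/
def IsCycle (C : G.ConnectedComponent) : Prop :=
  ∃ (v : ℤ × ℤ) (p : G.Walk v v), p.IsCycle ∧ p.toSubgraph = C.toSubgraph

/-- The planar set drawn by a component: the union of its edges. -/
def trace (C : G.ConnectedComponent) : Set (EuclideanSpace ℝ (Fin 2)) :=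
  {x | ∃ u v : ℤ × ℤ, u ∈ C.supp ∧ G.Adj u v ∧ x ∈ segment ℝ (toPlane u) (toPlane v)}

/-- `C` encloses the vertex `v`: `v` lies off `C`, in a bounded component of the complement of `C`
in the plane. -/
def Encloses (C : G.ConnectedComponent) (v : ℤ × ℤ) : Prop :=
  toPlane v ∉ trace C ∧ Bornology.IsBounded (connectedComponentIn (trace C)ᶜ (toPlane v))

/-- The face `f` lies along `C`: some edge of `C` joins two of the four corners of `f`. -/
def IsAlong (C : G.ConnectedComponent) (f : ℤ × ℤ) : Prop :=
  ∃ u v : ℤ × ℤ, u ∈ C.supp ∧ G.Adj u v ∧ u ∈ Set.Icc f (f + (1, 1)) ∧ v ∈ Set.Icc f (f + (1, 1))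

/-- The contour `C` is on level `l`: the black faces along `C` have height `l`. -/
def HasLevel (C : G.ConnectedComponent) (l : ℤ) : Prop :=
  ∃ H : ℤ × ℤ → ℤ, IsHeightFunction G H ∧ ∀ f, IsBlack f → IsAlong C f → H f = l

/-- The Euclidean diameter, in `[0, ∞]`, of the component of the origin. -/
noncomputable def originDiam (ξ η : ℤ → ℤˣ) : ℝ≥0∞ :=
  Metric.ediam (trace ((graph ξ η).connectedComponentMk (0, 0)))

/-- The random variables `ξ n` and `η m` (`n, m ∈ ℤ`) are all independent, and each of them is a
fair random sign. -/
structure IsFairSigns {Ω : Type*} [MeasurableSpace Ω] (μ : Measure Ω) (ξ η : ℤ → Ω → ℤˣ) :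
    Prop where
  measurable_left : ∀ n (s : ℤˣ), MeasurableSet {ω | ξ n ω = s}
  measurable_right : ∀ m (s : ℤˣ), MeasurableSet {ω | η m ω = s}
  fair_left : ∀ n (s : ℤˣ), μ {ω | ξ n ω = s} = 1 / 2
  fair_right : ∀ m (s : ℤˣ), μ {ω | η m ω = s} = 1 / 2
  indep : iIndepFun (m := fun _ => ⊤) (Sum.elim ξ η) μ

end CornerPercolation

/-!
# Corner percolation: no infinite components, nested cycles, and the tail of the diameter

Let `X` and `Y` be the two-sided walks with steps `-(-1) ^ n * ξ n` and `-(-1) ^ m * η m`; they are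
independent simple random walks.  Put `S (n, m) = X n + Y m` on the faces.  Then `S` is even on the
black faces and odd on the white ones, and an edge is present if and only if `S` takes the values
`2 * l` and `2 * l + 1` beside it (`encodes_graph`).  So the height is `S / 2` rounded up, the
components of level `l` are the contours between `S ≤ 2 * l` and `S > 2 * l`, and all of them follow
from the shape of `S`.

Two facts on contours are used.  A contour of level `l` cannot cross a closed ring of faces on which
`S ≤ 2 * l`, nor one on which `S > 2 * l` (`Encodes.mem_box_of_reachable`).  And if `S > 2 * l` on a
face inside a ring on which `S ≤ 2 * l`, then some contour of level `l` in the ring goes around this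
face (`Encodes.exists_contour`).  The Jordan curve theorem is not needed: a finite contour is even
at each vertex, so the parity of the number of crossings on the way to infinity defines its interior
(`Encodes.exists_isInterior`), and the squares of the interior form a bounded set that is cut off
from the rest of the plane by the contour (`Encodes.encloses`).

Rings come from the product structure: if both halves of `X` and of `Y` reach `-α` before they
exceed `β`, then `S ≤ β - α` on the rectangle given by the four hitting times
(`ringLE_of_arms`).  By the gambler's ruin estimate this has a probability bounded below on every
scale, so by the second Borel-Cantelli lemma there are almost surely arbitrarily large rings on
which `S` is very negative (`IsFairSigns.ae_hasLowRing`), and by symmetry arbitrarily large rings on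
which it is very positive.  The former confine every component, and between a positive ring and a
larger negative one there is a contour of each given level around everything inside.

For the tail, take a scale `g` of order `√n`.  With a probability bounded below there is a ring on
which `S ≤ -4 * g`, within distance of order `g ^ 2`, while `X > -2 * g` up to time `n`.  Then each
of `g` different levels has a contour around the face `(0, 0)` which crosses the right half-axis
beyond `n` (`Encodes.le_card_long`).  So, among the order of `g ^ 2` vertices of the half-axis within
this distance, an expected number of order at least `g` lies in contours of diameter more than `n`.
By translation invariance the origin does so with probability of order at least `1 / g`
(`IsFairSigns.le_prob_reachesLeft`), and this tail is not summable.
-/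

/-! ### Corner percolation coded by two walks; interiors of finite contours -/

namespace CornerPercolation

/-- The graph `G` is the corner percolation graph coded by two nearest neighbour walks `X`, `Y` on
`ℤ` started at `0`.  Put `S f = X f.1 + Y f.2` on the faces.  An edge belongs to `G` if and only if
the values of `S` on its two sides are `2 * l` and `2 * l + 1` for some `l`, that is, if they have
the same integer half `S / 2`.  The indices `n - 1` and `m - 1` occur because a face carries the
name of its lower left corner. -/
structure Encodes (G : SimpleGraph (ℤ × ℤ)) (X Y : ℤ → ℤ) : Prop where
  zero_left : X 0 = 0
  zero_right : Y 0 = 0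
  step_left : ∀ n, X n = X (n - 1) + 1 ∨ X n = X (n - 1) - 1
  step_right : ∀ n, Y n = Y (n - 1) + 1 ∨ Y n = Y (n - 1) - 1
  adj_up : ∀ n k, G.Adj (n, k) (n, k + 1) ↔ (X (n - 1) + Y k) / 2 = (X n + Y k) / 2
  adj_right : ∀ k m, G.Adj (k, m) (k + 1, m) ↔ (X k + Y (m - 1)) / 2 = (X k + Y m) / 2
  adj_cases : ∀ u v, G.Adj u v → v = (u.1, u.2 + 1) ∨ u = (v.1, v.2 + 1) ∨
    v = (u.1 + 1, u.2) ∨ u = (v.1 + 1, v.2)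

/-- The level of the edges at a vertex: half of the mean of `X + Y` over the four faces around it,
rounded down. -/
def vertexLevel (X Y : ℤ → ℤ) (v : ℤ × ℤ) : ℤ :=
  (X (v.1 - 1) + X v.1 + Y (v.2 - 1) + Y v.2) / 4

variable {G : SimpleGraph (ℤ × ℤ)} {X Y : ℤ → ℤ}

lemma parity_of_step {X : ℤ → ℤ} (h0 : X 0 = 0)
    (hs : ∀ n, X n = X (n - 1) + 1 ∨ X n = X (n - 1) - 1) (n : ℤ) : (X n + n) % 2 = 0 := by
  induction n using Int.induction_on with
  | zero => simp [h0]
  | succ i ih =>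
    have := hs (i + 1)
    rw [add_sub_cancel_right] at this
    omega
  | pred i ih =>
    have := hs (-i)
    omega

namespace Encodes

variable (h : Encodes G X Y)
include h

/-- Each vertex has exactly one vertical edge. -/
lemma adj_down (n k : ℤ) : G.Adj (n, k - 1) (n, k) ↔ ¬ G.Adj (n, k) (n, k + 1) := by
  have := h.adj_up n (k - 1)
  rw [sub_add_cancel] at this
  rw [this, h.adj_up]
  have := h.step_left n
  have := h.step_right k
  omega

/-- Each vertex has exactly one horizontal edge. -/
lemma adj_left (k m : ℤ) : G.Adj (k - 1, m) (k, m) ↔ ¬ G.Adj (k, m) (k + 1, m) := by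
  have := h.adj_right (k - 1) m
  rw [sub_add_cancel] at this
  rw [this, h.adj_right]
  have := h.step_left k
  have := h.step_right m
  omega

lemma level_up {n k : ℤ} (ha : G.Adj (n, k) (n, k + 1)) :
    vertexLevel X Y (n, k) = (X n + Y k) / 2 ∧ vertexLevel X Y (n, k + 1) = (X n + Y k) / 2 := by
  rw [h.adj_up] at ha
  have h1 := h.step_left n
  have h2 := h.step_right k
  have h3 := h.step_right (k + 1)
  simp only [vertexLevel, add_sub_cancel_right] at *
  omega

lemma level_right {k m : ℤ} (ha : G.Adj (k, m) (k + 1, m)) :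
    vertexLevel X Y (k, m) = (X k + Y m) / 2 ∧ vertexLevel X Y (k + 1, m) = (X k + Y m) / 2 := by
  rw [h.adj_right] at ha
  have h1 := h.step_right m
  have h2 := h.step_left k
  have h3 := h.step_left (k + 1)
  simp only [vertexLevel, add_sub_cancel_right] at *
  omega

lemma level_eq_of_adj {u v : ℤ × ℤ} (ha : G.Adj u v) :
    vertexLevel X Y u = vertexLevel X Y v := by
  obtain ⟨a, b⟩ := u
  obtain ⟨c, d⟩ := v
  rcases h.adj_cases _ _ ha with e | e | e | e <;> simp only [Prod.mk.injEq] at e <;>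
    obtain ⟨rfl, rfl⟩ := e
  · rw [(h.level_up ha).1, (h.level_up ha).2]
  · rw [(h.level_up ha.symm).1, (h.level_up ha.symm).2]
  · rw [(h.level_right ha).1, (h.level_right ha).2]
  · rw [(h.level_right ha.symm).1, (h.level_right ha.symm).2]

lemma level_eq_of_reachable {u v : ℤ × ℤ} (hr : G.Reachable u v) :
    vertexLevel X Y u = vertexLevel X Y v := by
  obtain ⟨p⟩ := hr
  induction p with
  | nil => rfl
  | cons ha _ ih => exact (h.level_eq_of_adj ha).trans ih

/-- A contour of level `l` cannot leave a rectangle if the faces along the boundary of the rectangle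
do not show both of the values `2 * l` and `2 * l + 1`.  The faces of the rectangle are
`[a₁, a₂] × [b₁, b₂]`, so the vertices inside the ring are those in `(a₁, a₂] × (b₁, b₂]`. -/
lemma mem_box_of_reachable {l a₁ a₂ b₁ b₂ : ℤ} {P : ℤ → Prop} (hP : ¬ (P (2 * l) ∧ P (2 * l + 1)))
    (hb : ∀ n, a₁ ≤ n → n ≤ a₂ → P (X n + Y b₁) ∧ P (X n + Y b₂))
    (ha : ∀ m, b₁ ≤ m → m ≤ b₂ → P (X a₁ + Y m) ∧ P (X a₂ + Y m))
    {u v : ℤ × ℤ} (hu : u ∈ Set.Ioc a₁ a₂ ×ˢ Set.Ioc b₁ b₂) (hl : vertexLevel X Y u = l)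
    (hr : G.Reachable u v) : v ∈ Set.Ioc a₁ a₂ ×ˢ Set.Ioc b₁ b₂ := by
  -- the two faces beside an edge of level `l` carry the two values `2 * l` and `2 * l + 1`
  have key : ∀ s t : ℤ, P s → P t → (s = t + 1 ∨ s = t - 1) → s / 2 = t / 2 → t / 2 = l → False := by
    intro s t hs ht hst he hl
    rcases hst with e | e
    · exact hP ⟨by convert ht using 1; omega, by convert hs using 1; omega⟩
    · exact hP ⟨by convert hs using 1; omega, by convert ht using 1; omega⟩
  obtain ⟨p⟩ := hr
  induction p with
  | nil => exact hu
  | @cons u v w hadj _ ih =>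
    refine ih ?_ ((h.level_eq_of_adj hadj).symm.trans hl)
    obtain ⟨a, b⟩ := u
    obtain ⟨c, d⟩ := v
    simp only [Set.mem_prod, Set.mem_Ioc] at hu ⊢
    rcases h.adj_cases _ _ hadj with e | e | e | e <;> simp only [Prod.mk.injEq] at e <;>
      obtain ⟨rfl, rfl⟩ := e
    · have h1 := h.level_up hadj
      rw [h.adj_up] at hadj
      refine ⟨hu.1, by omega, ?_⟩
      by_contra hc
      obtain rfl : b = b₂ := by omega
      have h2 := h.step_left c
      exact key _ _ (hb (c - 1) (by omega) (by omega)).2 (hb c (by omega) (by omega)).2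
        (by omega) hadj (by omega)
    · have h1 := h.level_up hadj.symm
      have hadj := hadj.symm
      rw [h.adj_up] at hadj
      refine ⟨hu.1, ?_, by omega⟩
      by_contra hc
      obtain rfl : d = b₁ := by omega
      have h2 := h.step_left a
      exact key _ _ (hb (a - 1) (by omega) (by omega)).1 (hb a (by omega) (by omega)).1
        (by omega) hadj (by omega)
    · have h1 := h.level_right hadj
      rw [h.adj_right] at hadj
      refine ⟨⟨by omega, ?_⟩, hu.2⟩
      by_contra hc
      obtain rfl : a = a₂ := by omega
      have h2 := h.step_right d
      exact key _ _ (ha (d - 1) (by omega) (by omega)).2 (ha d (by omega) (by omega)).2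
        (by omega) hadj (by omega)
    · have h1 := h.level_right hadj.symm
      have hadj := hadj.symm
      rw [h.adj_right] at hadj
      refine ⟨⟨?_, by omega⟩, hu.2⟩
      by_contra hc
      obtain rfl : c = a₁ := by omega
      have h2 := h.step_right b
      exact key _ _ (ha (b - 1) (by omega) (by omega)).1 (ha b (by omega) (by omega)).1
        (by omega) hadj (by omega)

end Encodes

/-- The vertical edge from `(n, k)` to `(n, k + 1)` belongs to `C`. -/
def VertEdge (C : G.ConnectedComponent) (n k : ℤ) : Prop :=
  (n, k) ∈ C.supp ∧ G.Adj (n, k) (n, k + 1)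

/-- The horizontal edge from `(k, m)` to `(k + 1, m)` belongs to `C`. -/
def HorEdge (C : G.ConnectedComponent) (k m : ℤ) : Prop :=
  (k, m) ∈ C.supp ∧ G.Adj (k, m) (k + 1, m)

/-- `F` is the set of faces inside the contour `C`: a finite set of faces whose boundary consists of
the edges of `C`. -/
structure IsInterior (C : G.ConnectedComponent) (F : Set (ℤ × ℤ)) : Prop where
  finite : F.Finite
  right : ∀ n m, ((n, m) ∈ F ↔ (n + 1, m) ∈ F) ↔ ¬ VertEdge C (n + 1) m
  up : ∀ n m, ((n, m) ∈ F ↔ (n, m + 1) ∈ F) ↔ ¬ HorEdge C n (m + 1)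

lemma supp_iff_of_adj (C : G.ConnectedComponent) {u v : ℤ × ℤ} (ha : G.Adj u v) :
    u ∈ C.supp ↔ v ∈ C.supp := by
  simp only [SimpleGraph.ConnectedComponent.mem_supp_iff]
  rw [SimpleGraph.ConnectedComponent.sound ha.reachable]

lemma exists_bound_of_finite {s : Set (ℤ × ℤ)} (hs : s.Finite) :
    ∃ B : ℤ, 0 ≤ B ∧ ∀ v ∈ s, |v.1| < B ∧ |v.2| < B := by
  obtain ⟨B, hB⟩ := (hs.image fun v : ℤ × ℤ => max |v.1| |v.2|).bddAbove
  refine ⟨max 0 (B + 1), le_max_left _ _, fun v hv => ?_⟩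
  have := hB (Set.mem_image_of_mem _ hv)
  simp only [max_le_iff] at this
  constructor <;> rw [lt_max_iff] <;> right <;> omega

/-- A finite contour has an interior: the faces `f` such that an odd number of edges of `C` is crossed
on the way from `f` to infinity in the direction of the first axis.  As `C` has an even number of
edges at each vertex, this parity changes precisely across the edges of `C`. -/
lemma Encodes.exists_isInterior (h : Encodes G X Y) {C : G.ConnectedComponent}
    (hC : C.supp.Finite) : ∃ F, IsInterior C F := by
  classical
  obtain ⟨B, hB0, hB⟩ := exists_bound_of_finite hC
  let v : ℤ → ℤ → ZMod 2 := fun n k => if VertEdge C n k then 1 else 0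
  let w : ℤ → ℤ → ZMod 2 := fun k m => if HorEdge C k m then 1 else 0
  have hv0 : ∀ n k, (B ≤ n ∨ n ≤ -B ∨ B ≤ k ∨ k ≤ -B) → v n k = 0 := by
    intro n k hnk
    refine if_neg fun hc => ?_
    have := hB _ hc.1
    simp only [abs_lt] at this
    omega
  have hw0 : ∀ n k, (B ≤ n ∨ n ≤ -B) → w n k = 0 := by
    intro n k hnk
    refine if_neg fun hc => ?_
    have := hB _ hc.1
    simp only [abs_lt] at this
    omega
  -- the component has exactly one vertical and one horizontal edge at each of its vertices
  have hvw : ∀ n m, v n m + v n (m - 1) = w n m + w (n - 1) m := by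
    intro n m
    have e1 := h.adj_down n m
    have e2 := h.adj_left n m
    have e3 : G.Adj (n, m - 1) (n, m) → ((n, m - 1) ∈ C.supp ↔ (n, m) ∈ C.supp) :=
      supp_iff_of_adj C
    have e4 : G.Adj (n - 1, m) (n, m) → ((n - 1, m) ∈ C.supp ↔ (n, m) ∈ C.supp) :=
      supp_iff_of_adj C
    simp only [v, w, VertEdge, HorEdge, sub_add_cancel]
    by_cases a1 : G.Adj (n, m) (n, m + 1) <;> by_cases a2 : G.Adj (n, m) (n + 1, m) <;>
      by_cases a3 : (n, m) ∈ C.supp <;> simp_all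
  -- the number modulo 2 of edges of `C` to the right of a face
  let p : ℤ → ℤ → ZMod 2 := fun n m => ∑ j ∈ Finset.Ioc n B, v j m
  have hp0 : ∀ n m, B ≤ n → p n m = 0 := by
    intro n m hn
    simp [p, Finset.Ioc_eq_empty_of_le hn]
  have hp1 : ∀ n m, p n m = p (n + 1) m + v (n + 1) m := by
    intro n m
    rcases lt_or_ge n B with hn | hn
    · have : Finset.Ioc n B = insert (n + 1) (Finset.Ioc (n + 1) B) := by
        ext j
        simp only [Finset.mem_insert, Finset.mem_Ioc]
        omega
      simp only [p]
      rw [this, Finset.sum_insert (by simp), add_comm]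
    · rw [hp0 _ _ hn, hp0 _ _ (by omega), hv0 _ _ (by omega), add_zero]
  -- vertical steps change the parity across the horizontal edges, by induction from the right
  have hp2 : ∀ m n, p n m + p n (m - 1) = w n m := by
    intro m n
    rcases le_or_gt B n with hn | hn
    · rw [hp0 _ _ hn, hp0 _ _ hn, hw0 _ _ (by omega), add_zero]
    · induction n, hn.le using Int.leInductionDown with
      | base => rw [hp0 _ _ le_rfl, hp0 _ _ le_rfl, hw0 _ _ (by omega), add_zero]
      | pred n hn' ih =>
        have i1 : p n m + p n (m - 1) = w n m := by
          rcases lt_or_ge n B with h' | h'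
          · exact ih h'
          · rw [hp0 _ _ h', hp0 _ _ h', hw0 _ _ (by omega), add_zero]
        have i2 := hp1 (n - 1) m
        have i3 := hp1 (n - 1) (m - 1)
        have i4 := hvw n m
        rw [sub_add_cancel] at i2 i3
        rw [i2, i3]
        calc p n m + v n m + (p n (m - 1) + v n (m - 1))
            = (p n m + p n (m - 1)) + (v n m + v n (m - 1)) := by ring
          _ = (w n m + w n m) + w (n - 1) m := by rw [i1, i4]; ring
          _ = _ := by rw [CharTwo.add_self_eq_zero, zero_add]
  have hpm : ∀ n m, (B ≤ m ∨ m ≤ -B) → p n m = 0 := fun n m hm =>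
    Finset.sum_eq_zero fun j _ => hv0 _ _ (by omega)
  -- far to the left no horizontal edge is left, so the parity is the same as high above `C`
  have hpn : ∀ n m, n ≤ -B → p n m = 0 := by
    intro n m hn
    rcases le_or_gt B m with hm | hm
    · exact hpm _ _ (by omega)
    · induction m, hm.le using Int.leInductionDown with
      | base => exact hpm _ _ (by omega)
      | pred m hm' ih =>
        have i1 : p n m = 0 := by
          rcases lt_or_ge m B with h' | h'
          · exact ih h'
          · exact hpm _ _ (by omega)
        have := hp2 m n
        rwa [i1, hw0 _ _ (by omega), zero_add] at this
  have fact : ∀ a b c : ZMod 2, ∀ q : Prop, [Decidable q] → a + b = c → c = (if q then 1 else 0) →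
      ((a = 1 ↔ b = 1) ↔ ¬ q) := by
    intro a b c q _
    by_cases hq : q <;> simp only [hq, if_true, if_false] <;> revert a b c <;> decide
  refine ⟨{f | p f.1 f.2 = 1}, ?_, ?_, ?_⟩
  · refine (Set.toFinite (Set.Icc (-B) B ×ˢ Set.Icc (-B) B)).subset ?_
    rintro ⟨n, m⟩ hnm
    simp only [Set.mem_ofPred_eq] at hnm
    by_contra hc
    simp only [Set.mem_prod, Set.mem_Icc] at hc
    have : p n m = 0 := by
      by_cases c1 : B ≤ n
      · exact hp0 _ _ c1
      by_cases c2 : n ≤ -B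
      · exact hpn _ _ c2
      exact hpm _ _ (by omega)
    rw [this] at hnm
    exact absurd hnm (by decide)
  · intro n m
    refine fact _ _ (v (n + 1) m) _ ?_ rfl
    show p n m + p (n + 1) m = _
    rw [hp1 n m, add_right_comm, CharTwo.add_self_eq_zero, zero_add]
  · intro n m
    refine fact _ _ (w n (m + 1)) _ ?_ rfl
    have := hp2 (m + 1) n
    rw [add_sub_cancel_right] at this
    rw [← this, add_comm]

end CornerPercolation

/-! ### Existence of contours between rings; components are cycles -/

namespace CornerPercolation
variable {G : SimpleGraph (ℤ × ℤ)} {X Y : ℤ → ℤ}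

/-- A property changes its truth value an odd number of times between `a` and `b` if and only if its
truth values at `a` and `b` differ. -/
lemma odd_card_changes (U : ℤ → Prop) [DecidablePred fun k => ¬ (U (k - 1) ↔ U k)] {a b : ℤ} (hab : a ≤ b) :
    Odd ((Finset.Ioc a b).filter fun k => ¬ (U (k - 1) ↔ U k)).card ↔ ¬ (U a ↔ U b) := by
  induction b, hab using Int.leInduction with
  | base => simp
  | succ b hab ih =>
    have : Finset.Ioc a (b + 1) = insert (b + 1) (Finset.Ioc a b) := by
      ext j
      simp only [Finset.mem_insert, Finset.mem_Ioc]
      omega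
    rw [this, Finset.filter_insert]
    split_ifs with hU <;> rw [add_sub_cancel_right] at hU
    · rw [ih]
      tauto
    · rw [Finset.card_insert_of_notMem (by simp), Nat.odd_add_one, ih]
      tauto

/-- From a face inside a contour, the contour is met in both horizontal directions. -/
lemma IsInterior.exists_vertEdge {C : G.ConnectedComponent} {F : Set (ℤ × ℤ)}
    (hF : IsInterior C F) {n m : ℤ} (hn : (n, m) ∈ F) :
    (∃ k, n < k ∧ VertEdge C k m) ∧ ∃ k ≤ n, VertEdge C k m := by
  obtain ⟨B, -, hB⟩ := exists_bound_of_finite hF.finite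
  constructor
  · by_contra! hc
    have : ∀ k, n ≤ k → (k, m) ∈ F := by
      intro k hk
      induction k, hk using Int.leInduction with
      | base => exact hn
      | succ k hk ih => exact ((hF.right k m).2 (hc _ (by omega))).1 ih
    have := (hB _ (this (max n B) (le_max_left _ _))).1
    rw [abs_lt] at this
    simp only at this
    omega
  · by_contra! hc
    have : ∀ k, k ≤ n → (k, m) ∈ F := by
      intro k hk
      induction k, hk using Int.leInductionDown with
      | base => exact hn
      | pred k hk ih =>
        have := (hF.right (k - 1) m)
        rw [sub_add_cancel] at this
        exact (this.2 (hc _ (by omega))).2 ih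
    have := (hB _ (this (min n (-B)) (min_le_left _ _))).1
    rw [abs_lt] at this
    simp only at this
    omega

namespace Encodes

variable (h : Encodes G X Y)
include h

/-- If `S = X + Y` is at most `2 * l` on the boundary of a rectangle of faces and exceeds `2 * l` on a
face of the rectangle, then a contour of level `l` inside the rectangle surrounds that face: on
the way to the right an odd number of edges of level `l` is crossed, so at least one of the contours
they belong to is crossed an odd number of times. -/
lemma exists_contour {l a₁ a₂ b₁ b₂ : ℤ}
    (hb : ∀ n, a₁ ≤ n → n ≤ a₂ → X n + Y b₁ ≤ 2 * l ∧ X n + Y b₂ ≤ 2 * l)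
    (ha : ∀ m, b₁ ≤ m → m ≤ b₂ → X a₁ + Y m ≤ 2 * l ∧ X a₂ + Y m ≤ 2 * l)
    {n m : ℤ} (hn : n ∈ Set.Icc a₁ a₂) (hm : m ∈ Set.Icc b₁ b₂) (hS : 2 * l < X n + Y m) :
    ∃ (C : G.ConnectedComponent) (F : Set (ℤ × ℤ)), IsInterior C F ∧ (n, m) ∈ F ∧
      C.supp ⊆ Set.Ioc a₁ a₂ ×ˢ Set.Ioc b₁ b₂ ∧ ∀ v ∈ C.supp, vertexLevel X Y v = l := by
  classical
  by_contra! hno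
  obtain ⟨hn1, hn2⟩ := hn
  obtain ⟨hm1, hm2⟩ := hm
  have hm3 : b₁ < m := by
    rcases hm1.lt_or_eq with h1 | h1
    · exact h1
    · have := (hb n hn1 hn2).1
      rw [h1] at this
      omega
  let U : ℤ → Prop := fun k => 2 * l < X k + Y m
  let K := (Finset.Ioc n a₂).filter fun k => ¬ (U (k - 1) ↔ U k)
  have hK : Odd K.card := by
    rw [odd_card_changes U hn2]
    have := (ha m hm1 hm2).2
    simp only [U]
    omega
  have hKl : ∀ k, k ∈ K ↔ (n < k ∧ k ≤ a₂) ∧ G.Adj (k, m) (k, m + 1) ∧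
      vertexLevel X Y (k, m) = l := by
    intro k
    simp only [K, U, Finset.mem_filter, Finset.mem_Ioc]
    refine and_congr_right fun _ => ?_
    have := h.step_left k
    constructor
    · intro hk
      have hadj : G.Adj (k, m) (k, m + 1) := by
        rw [h.adj_up]
        omega
      refine ⟨hadj, ?_⟩
      rw [(h.level_up hadj).1]
      omega
    · rintro ⟨hadj, hl⟩
      rw [(h.level_up hadj).1] at hl
      rw [h.adj_up] at hadj
      omega
  clear_value K
  let c : ℤ → G.ConnectedComponent := fun k => G.connectedComponentMk (k, m)
  refine Nat.not_even_iff_odd.2 hK ?_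
  rw [Finset.card_eq_sum_card_image c]
  refine Finset.even_sum _ fun C hC => ?_
  obtain ⟨k, hk, rfl⟩ := Finset.mem_image.1 hC
  have hk' := (hKl k).1 hk
  have hlev : ∀ v ∈ (c k).supp, vertexLevel X Y v = l := fun v hv =>
    (h.level_eq_of_reachable (SimpleGraph.ConnectedComponent.exact hv)).trans hk'.2.2
  have hbox : (c k).supp ⊆ Set.Ioc a₁ a₂ ×ˢ Set.Ioc b₁ b₂ := fun v hv =>
    h.mem_box_of_reachable (P := fun s => s ≤ 2 * l) (by omega) hb ha
      (u := (k, m)) ⟨⟨by simp only; omega, by simp only; omega⟩, hm3, hm2⟩ hk'.2.2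
      (SimpleGraph.ConnectedComponent.exact hv).symm
  have hfin : (c k).supp.Finite :=
    ((Set.finite_Ioc a₁ a₂).prod (Set.finite_Ioc b₁ b₂)).subset hbox
  obtain ⟨F, hF⟩ := h.exists_isInterior hfin
  have hnF : (n, m) ∉ F := fun hnF => by
    obtain ⟨v, hv, hv'⟩ := hno _ F hF hnF hbox
    exact hv' (hlev v hv)
  have haF : (a₂, m) ∉ F := fun haF => by
    obtain ⟨j, hj, hj'⟩ := (hF.exists_vertEdge haF).1
    have := (hbox hj'.1).1.2
    simp only at this
    omega
  have hfib : K.filter (fun j => c j = c k) =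
      (Finset.Ioc n a₂).filter fun j => ¬ ((j - 1, m) ∈ F ↔ (j, m) ∈ F) := by
    ext j
    have := hF.right (j - 1) m
    rw [sub_add_cancel] at this
    rw [Finset.mem_filter, Finset.mem_filter, hKl, this, not_not, VertEdge, Finset.mem_Ioc,
      SimpleGraph.ConnectedComponent.mem_supp_iff]
    constructor
    · rintro ⟨⟨h1, h2, h3⟩, h4⟩
      exact ⟨h1, h4, h2⟩
    · rintro ⟨h1, h4, h2⟩
      exact ⟨⟨h1, h2, hlev _ h4⟩, h4⟩
  rw [hfib, ← Nat.not_odd_iff_even, odd_card_changes (fun j => (j, m) ∈ F) hn2]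
  tauto

/-- A contour of level `l` with a face of a ring `S > 2 * l` in its interior stays outside that ring. -/
lemma disjoint_supp_of_ring {l a₁ a₂ b₁ b₂ : ℤ}
    (hb : ∀ n, a₁ ≤ n → n ≤ a₂ → 2 * l < X n + Y b₁ ∧ 2 * l < X n + Y b₂)
    (ha : ∀ m, b₁ ≤ m → m ≤ b₂ → 2 * l < X a₁ + Y m ∧ 2 * l < X a₂ + Y m)
    {C : G.ConnectedComponent} {F : Set (ℤ × ℤ)} (hF : IsInterior C F)
    (hC : ∀ v ∈ C.supp, vertexLevel X Y v = l) {m : ℤ} (hm : (a₂, m) ∈ F) :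
    Disjoint C.supp (Set.Ioc a₁ a₂ ×ˢ Set.Ioc b₁ b₂) := by
  rw [Set.disjoint_left]
  intro v hv hv'
  obtain ⟨k, hk, hk'⟩ := (hF.exists_vertEdge hm).1
  have := h.mem_box_of_reachable (P := fun s => 2 * l < s) (by omega) hb ha hv' (hC v hv)
    (C.reachable_of_mem_supp hv hk'.1)
  have := this.1.2
  simp only at this
  omega

/-- Between a ring of faces with `S > 2 * l` and a larger ring with `S ≤ 2 * l` there is a contour of
level `l` around any given face `(n, m)` within the smaller ring. -/
lemma exists_contour_around {l a₁ a₂ b₁ b₂ c₁ c₂ d₁ d₂ : ℤ}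
    (hb : ∀ n, a₁ ≤ n → n ≤ a₂ → 2 * l < X n + Y b₁ ∧ 2 * l < X n + Y b₂)
    (ha : ∀ m, b₁ ≤ m → m ≤ b₂ → 2 * l < X a₁ + Y m ∧ 2 * l < X a₂ + Y m)
    (hd : ∀ n, c₁ ≤ n → n ≤ c₂ → X n + Y d₁ ≤ 2 * l ∧ X n + Y d₂ ≤ 2 * l)
    (hc : ∀ m, d₁ ≤ m → m ≤ d₂ → X c₁ + Y m ≤ 2 * l ∧ X c₂ + Y m ≤ 2 * l)
    (hca₁ : c₁ ≤ a₁) (hca₂ : a₂ ≤ c₂) (hdb₁ : d₁ ≤ b₁) (hdb₂ : b₂ ≤ d₂)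
    {n m : ℤ} (hn : n ∈ Set.Ioc a₁ a₂) (hm : m ∈ Set.Ioc b₁ b₂) :
    ∃ (C : G.ConnectedComponent) (F : Set (ℤ × ℤ)), IsInterior C F ∧ (n, m) ∈ F ∧
      C.supp.Finite ∧ (∀ v ∈ C.supp, vertexLevel X Y v = l) ∧
      Disjoint C.supp (Set.Ioc a₁ a₂ ×ˢ Set.Ioc b₁ b₂) := by
  simp only [Set.mem_Ioc] at hn hm
  obtain ⟨C, F, hF, hmem, hbox, hl⟩ := h.exists_contour hd hc (n := a₂) (m := m)
    ⟨by omega, hca₂⟩ ⟨by omega, by omega⟩ (ha m hm.1.le hm.2).2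
  have hdisj := h.disjoint_supp_of_ring hb ha hF hl hmem
  refine ⟨C, F, hF, ?_, ((Set.finite_Ioc c₁ c₂).prod (Set.finite_Ioc d₁ d₂)).subset hbox, hl,
    hdisj⟩
  have : ∀ k, k ≤ a₂ → a₁ < k → (k, m) ∈ F := by
    intro k hk
    induction k, hk using Int.leInductionDown with
    | base => exact fun _ => hmem
    | pred k hk ih =>
      intro hk'
      have hk2 := hF.right (k - 1) m
      rw [sub_add_cancel] at hk2
      refine (hk2.2 fun hv => ?_).2 (ih (by omega))
      exact Set.disjoint_left.1 hdisj hv.1 ⟨⟨by simp only; omega, hk⟩, hm⟩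
  exact this n hn.2 hn.1

/-- Every vertex of `G` has degree 2. -/
lemma isCycles : G.IsCycles := by
  rintro ⟨n, m⟩ -
  have e1 := h.adj_down n m
  have e2 := h.adj_left n m
  have key : ∃ a b, a ≠ b ∧ G.neighborSet (n, m) = {a, b} := by
    have hN : ∀ w, G.Adj (n, m) w ↔ (w = (n, m + 1) ∧ G.Adj (n, m) (n, m + 1)) ∨
        (w = (n, m - 1) ∧ G.Adj (n, m - 1) (n, m)) ∨
        (w = (n + 1, m) ∧ G.Adj (n, m) (n + 1, m)) ∨ (w = (n - 1, m) ∧ G.Adj (n - 1, m) (n, m)) := by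
      rintro ⟨a, b⟩
      constructor
      · intro hadj
        rcases h.adj_cases _ _ hadj with e | e | e | e <;> simp only [Prod.mk.injEq] at e <;>
          obtain ⟨rfl, rfl⟩ := e
        · exact Or.inl ⟨rfl, hadj⟩
        · exact Or.inr (Or.inl ⟨by simp, by simpa using hadj.symm⟩)
        · exact Or.inr (Or.inr (Or.inl ⟨rfl, hadj⟩))
        · exact Or.inr (Or.inr (Or.inr ⟨by simp, by simpa using hadj.symm⟩))
      · rintro (⟨e, h'⟩ | ⟨e, h'⟩ | ⟨e, h'⟩ | ⟨e, h'⟩) <;> rw [e]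
        exacts [h', h'.symm, h', h'.symm]
    by_cases a1 : G.Adj (n, m) (n, m + 1) <;> by_cases a2 : G.Adj (n, m) (n + 1, m)
    · refine ⟨(n, m + 1), (n + 1, m), by simp, ?_⟩
      ext w
      rw [SimpleGraph.mem_neighborSet, hN]
      simp [e1, e2, a1, a2]
    · refine ⟨(n, m + 1), (n - 1, m), by simp, ?_⟩
      ext w
      rw [SimpleGraph.mem_neighborSet, hN]
      simp [e1, e2, a1, a2]
    · refine ⟨(n, m - 1), (n + 1, m), by simp, ?_⟩
      ext w
      rw [SimpleGraph.mem_neighborSet, hN]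
      simp [e1, e2, a1, a2]
    · refine ⟨(n, m - 1), (n - 1, m), by simp, ?_⟩
      ext w
      rw [SimpleGraph.mem_neighborSet, hN]
      simp [e1, e2, a1, a2]
  obtain ⟨a, b, hab, hN⟩ := key
  rw [hN, Set.ncard_pair hab]

lemma nonempty_neighborSet (v : ℤ × ℤ) : (G.neighborSet v).Nonempty := by
  obtain ⟨n, m⟩ := v
  by_cases a1 : G.Adj (n, m) (n, m + 1)
  · exact ⟨_, a1⟩
  · exact ⟨_, ((h.adj_down n m).2 a1).symm⟩

end Encodes

/-- A finite component in which all degrees are 2 is a cycle.  The Mathlib lemma on graphs all of whose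
degrees are 0 or 2 wants a finite vertex set, so it is applied to the component alone, and the walk
that it gives is mapped back. -/
lemma isCycle_of_isCycles (hG : G.IsCycles) {C : G.ConnectedComponent} (hC : C.supp.Finite)
    (hne : ∀ v ∈ C.supp, (G.neighborSet v).Nonempty) : IsCycle C := by
  have : Finite C := hC
  obtain ⟨v, hv⟩ := C.nonempty_supp
  have hnb : ∀ u : C, C.toSimpleGraph.neighborSet u = Subtype.val ⁻¹' G.neighborSet u.1 := by
    intro u
    rfl
  have himg : ∀ u : C, Subtype.val '' C.toSimpleGraph.neighborSet u = G.neighborSet u.1 := by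
    intro u
    rw [hnb]
    ext w
    constructor
    · rintro ⟨w, hw, rfl⟩
      exact hw
    · intro hw
      exact ⟨⟨w, (supp_iff_of_adj C hw).1 u.2⟩, hw, rfl⟩
  have hcyc : C.toSimpleGraph.IsCycles := by
    intro u _
    rw [← hG (hne u.1 u.2), ← himg u, Set.ncard_image_of_injective _ Subtype.val_injective]
  have hne' : ∀ u : C, (C.toSimpleGraph.neighborSet u).Nonempty := by
    intro u
    rw [← Set.image_nonempty (f := Subtype.val), himg]
    exact hne u.1 u.2
  obtain ⟨p, hp, hpv⟩ := hcyc.exists_cycle_toSubgraph_verts_eq_connectedComponentSupp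
    (v := ⟨v, hv⟩) (c := C.toSimpleGraph.connectedComponentMk ⟨v, hv⟩) rfl (hne' _)
  have hinj : Function.Injective C.toSimpleGraph_hom := Subtype.val_injective
  have hq : (p.map C.toSimpleGraph_hom).IsCycle := hp.map hinj
  have hsupp : ∀ u, u ∈ (p.map C.toSimpleGraph_hom).support ↔ u ∈ C.supp := by
    intro u
    rw [SimpleGraph.Walk.support_map, List.mem_map]
    constructor
    · rintro ⟨w, -, rfl⟩
      exact w.2
    · intro hu
      refine ⟨⟨u, hu⟩, ?_, rfl⟩
      rw [← SimpleGraph.Walk.mem_verts_toSubgraph, hpv]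
      exact SimpleGraph.ConnectedComponent.sound (C.reachable_toSimpleGraph hu hv)
  refine ⟨v, p.map C.toSimpleGraph_hom, hq, ?_⟩
  have hverts : (p.map C.toSimpleGraph_hom).toSubgraph.verts = C.toSubgraph.verts := by
    ext u
    rw [SimpleGraph.Walk.mem_verts_toSubgraph, hsupp]
    rfl
  refine SimpleGraph.Subgraph.ext hverts ?_
  ext u w
  have hCadj : C.toSubgraph.Adj u w ↔ u ∈ C.supp ∧ G.Adj u w := by
    constructor
    · intro ha
      exact ⟨ha.fst_mem, ha.adj_sub⟩
    · rintro ⟨hu, ha⟩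
      exact ⟨hu, (supp_iff_of_adj C ha).1 hu, ha⟩
  rw [hCadj]
  constructor
  · intro ha
    refine ⟨(hsupp u).1 ((SimpleGraph.Walk.mem_verts_toSubgraph _).1 ha.fst_mem), ha.adj_sub⟩
  · rintro ⟨hu, ha⟩
    have h1 := hq.ncard_neighborSet_toSubgraph_eq_two ((hsupp u).2 hu)
    have h2 := hG (hne u hu)
    have := Set.eq_of_subset_of_ncard_le
      ((p.map C.toSimpleGraph_hom).toSubgraph.neighborSet_subset u) (by rw [h1, h2])
      (Set.finite_of_ncard_ne_zero (by rw [h2]; norm_num))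
    have hw : w ∈ G.neighborSet u := ha
    rwa [← this] at hw

end CornerPercolation

/-! ### The walks of a corner percolation graph, its height function, and enclosing in the plane -/

namespace CornerPercolation
variable {G : SimpleGraph (ℤ × ℤ)} {X Y : ℤ → ℤ}

/-- The step `X n - X (n - 1) = -(-1) ^ n * ξ n` of the walk attached to the signs `ξ`. -/
def step (ξ : ℤ → ℤˣ) (n : ℤ) : ℤ := -((n.negOnePow * ξ n : ℤˣ) : ℤ)

/-- The two-sided walk on `ℤ` with `walk d 0 = 0` and increments `walk d n - walk d (n - 1) = d n`. -/
def walk (d : ℤ → ℤ) : ℤ → ℤ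
  | Int.ofNat n => ∑ i ∈ Finset.range n, d (i + 1)
  | Int.negSucc n => -∑ i ∈ Finset.range (n + 1), d (-i)

lemma walk_zero (d : ℤ → ℤ) : walk d 0 = 0 := by
  show walk d (Int.ofNat 0) = 0
  simp [walk]

lemma walk_natCast (d : ℤ → ℤ) (n : ℕ) : walk d n = ∑ i ∈ Finset.range n, d (i + 1) := rfl

lemma walk_neg_natCast (d : ℤ → ℤ) (n : ℕ) :
    walk d (-n) = ∑ i ∈ Finset.range n, -d (-i) := by
  rw [Finset.sum_neg_distrib]
  cases n with
  | zero => simpa using walk_zero d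
  | succ n => rfl

lemma walk_eq (d : ℤ → ℤ) (n : ℤ) : walk d n = walk d (n - 1) + d n := by
  obtain ⟨n, rfl | rfl⟩ := n.eq_nat_or_neg
  · cases n with
    | zero =>
      have := walk_neg_natCast d 1
      simp only [Nat.cast_one, Finset.range_one, Finset.sum_singleton, Nat.cast_zero,
        neg_zero] at this
      simp [walk_zero, this]
    | succ n =>
      rw [show ((n + 1 : ℕ) : ℤ) - 1 = (n : ℕ) by push_cast; ring, walk_natCast, walk_natCast,
        Finset.sum_range_succ]
      push_cast
      ring
  · rw [show -(n : ℤ) - 1 = -((n + 1 : ℕ) : ℤ) by push_cast; ring, walk_neg_natCast,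
      walk_neg_natCast, Finset.sum_range_succ]
    ring

lemma step_eq (ξ : ℤ → ℤˣ) (n : ℤ) : step ξ n = 1 ∨ step ξ n = -1 := by
  rcases Int.units_eq_one_or (n.negOnePow * ξ n) with h | h <;> simp [step, h]

lemma graph_adj_up (ξ η : ℤ → ℤˣ) (n k : ℤ) : (graph ξ η).Adj (n, k) (n, k + 1) ↔
    (ξ n = 1 ∧ Even k) ∨ (ξ n = -1 ∧ Odd k) := by
  simp only [graph, SimpleGraph.fromRel_adj, Prod.mk.injEq]
  grind

lemma graph_adj_right (ξ η : ℤ → ℤˣ) (k m : ℤ) : (graph ξ η).Adj (k, m) (k + 1, m) ↔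
    (η m = 1 ∧ Even k) ∨ (η m = -1 ∧ Odd k) := by
  simp only [graph, SimpleGraph.fromRel_adj, Prod.mk.injEq]
  grind

lemma walk_step_iff {X Y : ℤ → ℤ} {ξ : ℤ → ℤˣ} {n k : ℤ} (hX : X n = X (n - 1) + step ξ n)
    (hXn : (X n + n) % 2 = 0) (hYk : (Y k + k) % 2 = 0) :
    ((ξ n = 1 ∧ Even k) ∨ (ξ n = -1 ∧ Odd k)) ↔ (X (n - 1) + Y k) / 2 = (X n + Y k) / 2 := by
  have h1 : (1 : ℤˣ) ≠ -1 := by decide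
  have h2 : (-1 : ℤˣ) ≠ 1 := by decide
  rw [Int.even_iff, Int.odd_iff]
  rcases Int.even_or_odd n with hn | hn <;> rcases Int.units_eq_one_or (ξ n) with hξ | hξ <;>
    simp only [step, hξ, Int.negOnePow_even n, Int.negOnePow_odd n, hn, h1, h2, mul_one, true_and,
      false_and, or_false, false_or, Units.val_one, Units.val_neg, mul_neg, neg_neg]
      at hX ⊢ <;>
    first | rw [Int.even_iff] at hn | rw [Int.odd_iff] at hn
  all_goals omega

/-- Corner percolation is coded by the two walks with steps `step ξ` and `step η`. -/
lemma encodes_graph (ξ η : ℤ → ℤˣ) :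
    Encodes (graph ξ η) (walk (step ξ)) (walk (step η)) := by
  have hs : ∀ (ξ : ℤ → ℤˣ) (n : ℤ), walk (step ξ) n = walk (step ξ) (n - 1) + 1 ∨
      walk (step ξ) n = walk (step ξ) (n - 1) - 1 := by
    intro ξ n
    have := walk_eq (step ξ) n
    rcases step_eq ξ n with h | h <;> omega
  refine ⟨walk_zero _, walk_zero _, hs ξ, hs η, fun n k => ?_, fun k m => ?_, ?_⟩
  · rw [graph_adj_up]
    exact walk_step_iff (walk_eq _ _) (parity_of_step (walk_zero _) (hs ξ) n)
      (parity_of_step (walk_zero _) (hs η) k)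
  · rw [graph_adj_right, add_comm _ (walk (step η) (m - 1)), add_comm _ (walk (step η) m)]
    exact walk_step_iff (walk_eq _ _) (parity_of_step (walk_zero _) (hs η) m)
      (parity_of_step (walk_zero _) (hs ξ) k)
  · rintro ⟨a, b⟩ ⟨c, d⟩ hadj
    simp only [graph, SimpleGraph.fromRel_adj] at hadj
    tauto

namespace Encodes

variable (h : Encodes G X Y)
include h

/-- The height of a face is half of `S = X + Y`, rounded up: `S` is even precisely on the black
faces. -/
lemma isHeightFunction : IsHeightFunction G fun f => (X f.1 + Y f.2 + 1) / 2 := by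
  refine ⟨by simp [h.zero_left, h.zero_right], fun n m => ?_, fun n m => ?_⟩
  · have h1 := h.step_left (n + 1)
    have h2 := parity_of_step h.zero_left h.step_left n
    have h3 := parity_of_step h.zero_right h.step_right m
    have h4 := h.adj_up (n + 1) m
    rw [add_sub_cancel_right] at h1 h4
    simp only [increment, IsBlack, Int.even_iff]
    split_ifs with h5 h6
    · rw [h4] at h5
      omega
    · rw [h4] at h5
      omega
    · rw [h4] at h5
      omega
  · have h1 := h.step_right (m + 1)
    have h2 := parity_of_step h.zero_left h.step_left n
    have h3 := parity_of_step h.zero_right h.step_right m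
    have h4 := h.adj_right n (m + 1)
    rw [add_sub_cancel_right] at h1 h4
    simp only [increment, IsBlack, Int.even_iff]
    split_ifs with h5 h6
    · rw [h4] at h5
      omega
    · rw [h4] at h5
      omega
    · rw [h4] at h5
      omega

lemma hasLevel {C : G.ConnectedComponent} {l : ℤ} (hl : ∀ v ∈ C.supp, vertexLevel X Y v = l) :
    HasLevel C l := by
  refine ⟨_, h.isHeightFunction, ?_⟩
  rintro ⟨i, j⟩ hf ⟨u, v, hu, hadj, hfu, hfv⟩
  have h2 := parity_of_step h.zero_left h.step_left i
  have h3 := parity_of_step h.zero_right h.step_right j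
  simp only [IsBlack, Int.even_iff] at hf
  have key : (X i + Y j) / 2 = l := by
    obtain ⟨a, b⟩ := u
    obtain ⟨c, d⟩ := v
    have hl' := hl _ hu
    rw [Set.mem_Icc, Prod.le_def, Prod.le_def] at hfu hfv
    simp only [Prod.fst_add, Prod.snd_add] at hfu hfv
    rcases h.adj_cases _ _ hadj with e | e | e | e <;> simp only [Prod.mk.injEq] at e <;>
      obtain ⟨rfl, rfl⟩ := e
    · rw [(h.level_up hadj).1] at hl'
      rw [h.adj_up] at hadj
      obtain rfl : j = b := by omega
      obtain rfl | rfl : i = c ∨ i = c - 1 := by omega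
      all_goals omega
    · have hadj := hadj.symm
      rw [(h.level_up hadj).2] at hl'
      rw [h.adj_up] at hadj
      obtain rfl : j = d := by omega
      obtain rfl | rfl : i = a ∨ i = a - 1 := by omega
      all_goals omega
    · rw [(h.level_right hadj).1] at hl'
      rw [h.adj_right] at hadj
      obtain rfl : i = a := by omega
      obtain rfl | rfl : j = d ∨ j = d - 1 := by omega
      all_goals omega
    · have hadj := hadj.symm
      rw [(h.level_right hadj).2] at hl'
      rw [h.adj_right] at hadj
      obtain rfl : i = c := by omega
      obtain rfl | rfl : j = b ∨ j = b - 1 := by omega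
      all_goals omega
  simp only
  omega

end Encodes

lemma mem_segment_up {n k : ℤ} {x : EuclideanSpace ℝ (Fin 2)} :
    x ∈ segment ℝ (toPlane (n, k)) (toPlane (n, k + 1)) ↔
      x 0 = n ∧ (k : ℝ) ≤ x 1 ∧ x 1 ≤ k + 1 := by
  constructor
  · rintro ⟨a, b, ha, hb, hab, rfl⟩
    simp only [toPlane, PiLp.add_apply, PiLp.smul_apply, Matrix.cons_val_zero,
      Matrix.cons_val_one, smul_eq_mul]
    push_cast
    obtain rfl : a = 1 - b := by linarith
    refine ⟨by ring, by nlinarith, by nlinarith⟩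
  · rintro ⟨h0, h1, h2⟩
    refine ⟨k + 1 - x 1, x 1 - k, by linarith, by linarith, by ring, ?_⟩
    ext i
    fin_cases i
    · simp [toPlane, h0]
      ring
    · simp [toPlane]
      ring

lemma mem_segment_right {k m : ℤ} {x : EuclideanSpace ℝ (Fin 2)} :
    x ∈ segment ℝ (toPlane (k, m)) (toPlane (k + 1, m)) ↔
      x 1 = m ∧ (k : ℝ) ≤ x 0 ∧ x 0 ≤ k + 1 := by
  constructor
  · rintro ⟨a, b, ha, hb, hab, rfl⟩
    simp only [toPlane, PiLp.add_apply, PiLp.smul_apply, Matrix.cons_val_zero,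
      Matrix.cons_val_one, smul_eq_mul]
    push_cast
    obtain rfl : a = 1 - b := by linarith
    refine ⟨by ring, by nlinarith, by nlinarith⟩
  · rintro ⟨h0, h1, h2⟩
    refine ⟨k + 1 - x 0, x 0 - k, by linarith, by linarith, by ring, ?_⟩
    ext i
    fin_cases i
    · simp [toPlane]
      ring
    · simp [toPlane, h0]
      ring

namespace Encodes

variable (h : Encodes G X Y)
include h

lemma mem_trace {C : G.ConnectedComponent} {x : EuclideanSpace ℝ (Fin 2)} :
    x ∈ trace C ↔ (∃ n k : ℤ, VertEdge C n k ∧ x 0 = n ∧ (k : ℝ) ≤ x 1 ∧ x 1 ≤ k + 1) ∨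
      ∃ k m : ℤ, HorEdge C k m ∧ x 1 = m ∧ (k : ℝ) ≤ x 0 ∧ x 0 ≤ k + 1 := by
  constructor
  · rintro ⟨⟨a, b⟩, ⟨c, d⟩, hu, hadj, hx⟩
    rcases h.adj_cases _ _ hadj with e | e | e | e <;> simp only [Prod.mk.injEq] at e <;>
      obtain ⟨rfl, rfl⟩ := e
    · exact Or.inl ⟨_, _, ⟨hu, hadj⟩, mem_segment_up.1 hx⟩
    · rw [segment_symm] at hx
      exact Or.inl ⟨_, _, ⟨(supp_iff_of_adj C hadj).1 hu, hadj.symm⟩, mem_segment_up.1 hx⟩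
    · exact Or.inr ⟨_, _, ⟨hu, hadj⟩, mem_segment_right.1 hx⟩
    · rw [segment_symm] at hx
      exact Or.inr ⟨_, _, ⟨(supp_iff_of_adj C hadj).1 hu, hadj.symm⟩, mem_segment_right.1 hx⟩
  · rintro (⟨n, k, hv, hx⟩ | ⟨k, m, hv, hx⟩)
    · exact ⟨_, _, hv.1, hv.2, mem_segment_up.2 hx⟩
    · exact ⟨_, _, hv.1, hv.2, mem_segment_right.2 hx⟩

lemma toPlane_mem_trace {C : G.ConnectedComponent} {v : ℤ × ℤ} :
    toPlane v ∈ trace C ↔ v ∈ C.supp := by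
  obtain ⟨a, b⟩ := v
  rw [h.mem_trace]
  simp only [toPlane, Matrix.cons_val_zero, Matrix.cons_val_one]
  norm_cast
  constructor
  · rintro (⟨n, k, hv, rfl, h1, h2⟩ | ⟨k, m, hv, rfl, h1, h2⟩)
    · obtain rfl | rfl : b = k ∨ b = k + 1 := by omega
      exacts [hv.1, (supp_iff_of_adj C hv.2).1 hv.1]
    · obtain rfl | rfl : a = k ∨ a = k + 1 := by omega
      exacts [hv.1, (supp_iff_of_adj C hv.2).1 hv.1]
  · intro hv
    by_cases ha : G.Adj (a, b) (a, b + 1)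
    · exact Or.inl ⟨a, b, ⟨hv, ha⟩, rfl, by omega, by omega⟩
    · rw [← h.adj_down] at ha
      refine Or.inl ⟨a, b - 1, ⟨(supp_iff_of_adj C ha).2 hv, ?_⟩, rfl, by omega, by omega⟩
      rwa [sub_add_cancel]

end Encodes

/-- The face `f` as a closed unit square in the plane. -/
def cell (f : ℤ × ℤ) : Set (EuclideanSpace ℝ (Fin 2)) :=
  {x | ((f.1 : ℝ) ≤ x 0 ∧ x 0 ≤ f.1 + 1) ∧ (f.2 : ℝ) ≤ x 1 ∧ x 1 ≤ f.2 + 1}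

lemma isClosed_cell (f : ℤ × ℤ) : IsClosed (cell f) := by
  have h0 : Continuous fun x : EuclideanSpace ℝ (Fin 2) => x 0 := by fun_prop
  have h1 : Continuous fun x : EuclideanSpace ℝ (Fin 2) => x 1 := by fun_prop
  exact ((isClosed_le continuous_const h0).inter (isClosed_le h0 continuous_const)).inter
    ((isClosed_le continuous_const h1).inter (isClosed_le h1 continuous_const))

lemma isBounded_cell (f : ℤ × ℤ) : Bornology.IsBounded (cell f) := by
  rw [Metric.isBounded_iff_subset_closedBall (toPlane f)]
  refine ⟨2, fun x hx => ?_⟩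
  obtain ⟨⟨h1, h2⟩, h3, h4⟩ := hx
  rw [Metric.mem_closedBall, EuclideanSpace.dist_eq, Fin.sum_univ_two, Real.sqrt_le_left (by norm_num)]
  simp only [toPlane, Matrix.cons_val_zero, Matrix.cons_val_one, Real.dist_eq, sq_abs]
  nlinarith

lemma locallyFinite_cell : LocallyFinite cell := by
  intro x
  refine ⟨{y | |y 0 - x 0| < 1 ∧ |y 1 - x 1| < 1}, ?_, ?_⟩
  · have h0 : Continuous fun y : EuclideanSpace ℝ (Fin 2) => |y 0 - x 0| := by fun_prop
    have h1 : Continuous fun y : EuclideanSpace ℝ (Fin 2) => |y 1 - x 1| := by fun_prop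
    exact ((isOpen_lt h0 continuous_const).inter (isOpen_lt h1 continuous_const)).mem_nhds
      (by simp)
  · refine ((Set.finite_Icc (⌊x 0⌋ - 2) (⌊x 0⌋ + 2)).prod
      (Set.finite_Icc (⌊x 1⌋ - 2) (⌊x 1⌋ + 2))).subset ?_
    rintro f ⟨y, ⟨⟨h1, h2⟩, h3, h4⟩, h5, h6⟩
    rw [abs_lt] at h5 h6
    have := Int.floor_le (x 0)
    have := Int.floor_le (x 1)
    have := Int.lt_floor_add_one (x 0)
    have := Int.lt_floor_add_one (x 1)
    refine ⟨⟨?_, ?_⟩, ?_, ?_⟩ <;> rify <;> linarith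

/-- A point that is common to a square inside and a square outside of `C` lies on `C`. -/
lemma Encodes.mem_trace_of_mem_cell (h : Encodes G X Y) {C : G.ConnectedComponent}
    {F : Set (ℤ × ℤ)} (hF : IsInterior C F) {f g : ℤ × ℤ} (hf : f ∈ F) (hg : g ∉ F)
    {x : EuclideanSpace ℝ (Fin 2)} (hxf : x ∈ cell f) (hxg : x ∈ cell g) : x ∈ trace C := by
  have row : ∀ i m, ¬ ((i, m) ∈ F ↔ (i + 1, m) ∈ F) → x ∈ cell (i, m) → x ∈ cell (i + 1, m) →
      x ∈ trace C := by
    intro i m hi h1 h2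
    rw [hF.right, not_not] at hi
    simp only [cell, Set.mem_ofPred_eq] at h1 h2
    push_cast at h1 h2
    exact h.mem_trace.2 (Or.inl ⟨_, _, hi, by push_cast; linarith, by linarith, by linarith⟩)
  have col : ∀ i m, ¬ ((i, m) ∈ F ↔ (i, m + 1) ∈ F) → x ∈ cell (i, m) → x ∈ cell (i, m + 1) →
      x ∈ trace C := by
    intro i m hi h1 h2
    rw [hF.up, not_not] at hi
    simp only [cell, Set.mem_ofPred_eq] at h1 h2
    push_cast at h1 h2
    exact h.mem_trace.2 (Or.inr ⟨_, _, hi, by push_cast; linarith, by linarith, by linarith⟩)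
  obtain ⟨a, b⟩ := f
  obtain ⟨c, d⟩ := g
  obtain ⟨⟨f1, f2⟩, f3, f4⟩ := hxf
  obtain ⟨⟨g1, g2⟩, g3, g4⟩ := hxg
  simp only at f1 f2 f3 f4 g1 g2 g3 g4
  have e1 : a ≤ c + 1 := by rify; linarith
  have e2 : c ≤ a + 1 := by rify; linarith
  have e3 : b ≤ d + 1 := by rify; linarith
  have e4 : d ≤ b + 1 := by rify; linarith
  -- pass from `(a, b)` to `(c, d)` through `(c, b)`, which also contains the point
  by_cases hm : (c, b) ∈ F
  · obtain rfl | rfl | rfl : b = d ∨ b = d + 1 ∨ d = b + 1 := by omega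
    · exact absurd hm hg
    · exact col c d (by tauto) ⟨⟨g1, g2⟩, g3, g4⟩ ⟨⟨g1, g2⟩, f3, f4⟩
    · exact col c b (by tauto) ⟨⟨g1, g2⟩, f3, f4⟩ ⟨⟨g1, g2⟩, g3, g4⟩
  · obtain rfl | rfl | rfl : a = c ∨ a = c + 1 ∨ c = a + 1 := by omega
    · exact absurd hf hm
    · exact row c b (by tauto) ⟨⟨g1, g2⟩, f3, f4⟩ ⟨⟨f1, f2⟩, f3, f4⟩
    · exact row a b (by tauto) ⟨⟨f1, f2⟩, f3, f4⟩ ⟨⟨g1, g2⟩, f3, f4⟩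

/-- The combinatorial interior is enclosed in the topological sense: off `C`, the closed union of the
inner squares and the closed union of the outer squares are disjoint and cover the plane, and the
first of them is bounded. -/
lemma Encodes.encloses (h : Encodes G X Y) {C : G.ConnectedComponent} {F : Set (ℤ × ℤ)}
    (hF : IsInterior C F) {v : ℤ × ℤ} (hv : v ∈ F) (hvC : v ∉ C.supp) : Encloses C v := by
  have hvt : toPlane v ∉ trace C := h.toPlane_mem_trace.not.2 hvC
  refine ⟨hvt, ?_⟩
  let A := ⋃ f ∈ F, cell f
  let B := ⋃ f : (Fᶜ : Set (ℤ × ℤ)), cell f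
  have hA : IsClosed A := hF.finite.isClosed_biUnion fun f _ => isClosed_cell f
  have hB : IsClosed B := (locallyFinite_cell.comp_injective Subtype.val_injective).isClosed_iUnion
    fun f => isClosed_cell f
  have hAB : connectedComponentIn (trace C)ᶜ (toPlane v) ⊆ A ∪ B := by
    intro x _
    have hx : x ∈ cell (⌊x 0⌋, ⌊x 1⌋) :=
      ⟨⟨Int.floor_le _, (Int.lt_floor_add_one _).le⟩, Int.floor_le _, (Int.lt_floor_add_one _).le⟩
    by_cases hm : (⌊x 0⌋, ⌊x 1⌋) ∈ F
    · exact Or.inl (Set.mem_biUnion hm hx)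
    · exact Or.inr (Set.mem_iUnion.2 ⟨⟨_, hm⟩, hx⟩)
  have hsub : connectedComponentIn (trace C)ᶜ (toPlane v) ⊆ A := by
    intro x hx
    by_contra hxA
    have hxB : x ∈ B := (hAB hx).resolve_left hxA
    obtain ⟨y, hy, hyA, hyB⟩ := isPreconnected_closed_iff.1 isPreconnected_connectedComponentIn
      A B hA hB hAB ⟨toPlane v, mem_connectedComponentIn hvt, Set.mem_biUnion hv
        ⟨⟨by simp [toPlane], by simp [toPlane]⟩, by simp [toPlane], by simp [toPlane]⟩⟩
      ⟨x, hx, hxB⟩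
    obtain ⟨f, hf, hyf⟩ := Set.mem_iUnion₂.1 hyA
    obtain ⟨⟨g, hg⟩, hyg⟩ := Set.mem_iUnion.1 hyB
    exact connectedComponentIn_subset _ _ hy (h.mem_trace_of_mem_cell hF hf hg hyf hyg)
  exact ((Bornology.isBounded_biUnion hF.finite).2 fun f _ => isBounded_cell f).subset hsub

lemma lt_originDiam {ξ η : ℤ → ℤˣ} {u : ℤ × ℤ} (hu : (graph ξ η).Reachable (0, 0) u) {n : ℕ}
    (hn : u.1 < -n) : (n : ℝ≥0∞) < originDiam ξ η := by
  have h := encodes_graph ξ η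
  have h0 : toPlane (0, 0) ∈ trace ((graph ξ η).connectedComponentMk (0, 0)) :=
    h.toPlane_mem_trace.2 rfl
  have h1 : toPlane u ∈ trace ((graph ξ η).connectedComponentMk (0, 0)) :=
    h.toPlane_mem_trace.2 (SimpleGraph.ConnectedComponent.sound hu.symm)
  refine lt_of_lt_of_le ?_ (Metric.edist_le_ediam_of_mem h0 h1)
  rw [edist_dist, dist_eq_norm, ← ENNReal.ofReal_natCast,
    ENNReal.ofReal_lt_ofReal_iff_of_nonneg (by positivity)]
  refine lt_of_lt_of_le ?_ (PiLp.norm_apply_le _ 0)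
  have : ((u.1 : ℤ) : ℝ) < -n := by exact_mod_cast hn
  simp only [toPlane, PiLp.sub_apply, Matrix.cons_val_zero, Real.norm_eq_abs]
  rw [lt_abs]
  left
  push_cast
  linarith

end CornerPercolation

/-! ### Rings made from one-sided walks -/

namespace CornerPercolation
variable {G : SimpleGraph (ℤ × ℤ)} {X Y : ℤ → ℤ}

/-- `X + Y ≤ c` on the faces along the boundary of the rectangle `[a₁, a₂] × [b₁, b₂]` of faces. -/
structure RingLE (X Y : ℤ → ℤ) (c a₁ a₂ b₁ b₂ : ℤ) : Prop where
  hor : ∀ n, a₁ ≤ n → n ≤ a₂ → X n + Y b₁ ≤ c ∧ X n + Y b₂ ≤ c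
  vert : ∀ m, b₁ ≤ m → m ≤ b₂ → X a₁ + Y m ≤ c ∧ X a₂ + Y m ≤ c

lemma RingLE.mono {c c' a₁ a₂ b₁ b₂ : ℤ} (hr : RingLE X Y c a₁ a₂ b₁ b₂) (hc : c ≤ c') :
    RingLE X Y c' a₁ a₂ b₁ b₂ :=
  ⟨fun n hn hn' => ⟨(hr.hor n hn hn').1.trans hc, (hr.hor n hn hn').2.trans hc⟩,
    fun m hm hm' => ⟨(hr.vert m hm hm').1.trans hc, (hr.vert m hm hm').2.trans hc⟩⟩

/-- `X + Y` is at most `-R` on the boundary of some rectangle that contains `[-R, R]²`. -/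
def HasLowRing (X Y : ℤ → ℤ) (R : ℤ) : Prop :=
  ∃ a₁ a₂ b₁ b₂, a₁ ≤ -R ∧ R ≤ a₂ ∧ b₁ ≤ -R ∧ R ≤ b₂ ∧ RingLE X Y (-R) a₁ a₂ b₁ b₂

namespace Encodes

variable (h : Encodes G X Y)
include h

lemma finite_supp (hlow : ∀ R, HasLowRing X Y R) (C : G.ConnectedComponent) :
    C.supp.Finite := by
  obtain ⟨v, hv⟩ := C.nonempty_supp
  obtain ⟨a₁, a₂, b₁, b₂, h1, h2, h3, h4, hr⟩ :=
    hlow (max (max (|v.1| + 1) (|v.2| + 1)) (-(2 * vertexLevel X Y v)))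
  set R := max (max (|v.1| + 1) (|v.2| + 1)) (-(2 * vertexLevel X Y v)) with hR
  have r1 : |v.1| + 1 ≤ R := (le_max_left _ _).trans (le_max_left _ _)
  have r2 : |v.2| + 1 ≤ R := (le_max_right _ _).trans (le_max_left _ _)
  have r3 : -(2 * vertexLevel X Y v) ≤ R := le_max_right _ _
  have := abs_le.1 (le_refl |v.1|)
  have := abs_le.1 (le_refl |v.2|)
  refine ((Set.finite_Ioc a₁ a₂).prod (Set.finite_Ioc b₁ b₂)).subset fun u hu => ?_
  refine h.mem_box_of_reachable (P := fun s => s ≤ 2 * vertexLevel X Y v) (u := v) (by omega)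
    (fun n hn hn' => ?_) (fun m hm hm' => ?_)
    ⟨⟨by omega, by omega⟩, by omega, by omega⟩ rfl (C.reachable_of_mem_supp hv hu)
  · have := hr.hor n hn hn'
    omega
  · have := hr.vert m hm hm'
    omega

lemma infinite_cycles (hlow : ∀ R, HasLowRing X Y R) (hhigh : ∀ R, HasLowRing (-X) (-Y) R)
    (v : ℤ × ℤ) (l : ℤ) :
    {C : G.ConnectedComponent | IsCycle C ∧ Encloses C v ∧ HasLevel C l}.Infinite := by
  intro hfin
  have hreps : ((fun C : G.ConnectedComponent => C.nonempty_supp.some) ''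
    {C : G.ConnectedComponent | IsCycle C ∧ Encloses C v ∧ HasLevel C l}).Finite := hfin.image _
  obtain ⟨B, hB0, hB⟩ := exists_bound_of_finite (hreps.insert v)
  obtain ⟨a₁, a₂, b₁, b₂, h1, h2, h3, h4, hr⟩ := hhigh (max B (2 * l + 1))
  have r1 := le_max_left B (2 * l + 1)
  have r2 := le_max_right B (2 * l + 1)
  obtain ⟨c₁, c₂, d₁, d₂, h1', h2', h3', h4', hr'⟩ :=
    hlow (max (max (-(2 * l)) (max (-a₁) a₂)) (max (-b₁) b₂))
  set R := max (max (-(2 * l)) (max (-a₁) a₂)) (max (-b₁) b₂)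
  have s1 : -(2 * l) ≤ R := (le_max_left _ _).trans (le_max_left _ _)
  have s2 : -a₁ ≤ R := ((le_max_left _ _).trans (le_max_right _ _)).trans (le_max_left _ _)
  have s3 : a₂ ≤ R := ((le_max_right _ _).trans (le_max_right _ _)).trans (le_max_left _ _)
  have s4 : -b₁ ≤ R := (le_max_left _ _).trans (le_max_right _ _)
  have s5 : b₂ ≤ R := (le_max_right _ _).trans (le_max_right _ _)
  have hbox : ∀ w : ℤ × ℤ, |w.1| < B ∧ |w.2| < B → w ∈ Set.Ioc a₁ a₂ ×ˢ Set.Ioc b₁ b₂ := by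
    intro w hw
    rw [abs_lt, abs_lt] at hw
    exact ⟨⟨by omega, by omega⟩, by omega, by omega⟩
  have hvbox := hbox v (hB v (Set.mem_insert _ _))
  obtain ⟨C, F, hF, hvF, hC, hl, hdisj⟩ := h.exists_contour_around (l := l) (a₁ := a₁) (a₂ := a₂)
    (b₁ := b₁) (b₂ := b₂) (c₁ := c₁) (c₂ := c₂) (d₁ := d₁) (d₂ := d₂) (n := v.1) (m := v.2)
    (fun n hn hn' => by have := hr.hor n hn hn'; simp only [Pi.neg_apply] at this; omega)
    (fun n hn hn' => by have := hr.vert n hn hn'; simp only [Pi.neg_apply] at this; omega)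
    (fun n hn hn' => by have := hr'.hor n hn hn'; omega)
    (fun n hn hn' => by have := hr'.vert n hn hn'; omega)
    (by omega) (by omega) (by omega) (by omega) hvbox.1 hvbox.2
  have hCmem : C ∈ {C : G.ConnectedComponent | IsCycle C ∧ Encloses C v ∧ HasLevel C l} :=
    ⟨isCycle_of_isCycles h.isCycles hC fun u _ => h.nonempty_neighborSet u,
      h.encloses hF hvF fun hvC => Set.disjoint_left.1 hdisj hvC hvbox, h.hasLevel hl⟩
  exact Set.disjoint_left.1 hdisj C.nonempty_supp.some_mem
    (hbox _ (hB _ (Set.mem_insert_of_mem _ (Set.mem_image_of_mem _ hCmem))))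

open Classical in
/-- If `X + Y ≤ -4 * g` on a ring around the origin that meets the right half-axis at distance at most
`N`, then each of the `g` levels in `[-2 * g, -g)` has a contour around the face `(0, 0)`.  It crosses
the right half-axis at a vertex `(k, 0)`, where `k > n` if `X` is larger than `-2 * g` up to time `n`,
and it crosses the left half-axis as well.  Different levels give different `k`. -/
lemma le_card_long {g : ℕ} {n N a₁ a₂ b₁ b₂ : ℤ} (hr : RingLE X Y (-(4 * g)) a₁ a₂ b₁ b₂)
    (ha₁ : a₁ ≤ 0) (ha₂ : 0 ≤ a₂) (hb₁ : b₁ ≤ 0) (hb₂ : 0 ≤ b₂) (hN : a₂ ≤ N)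
    (hn : ∀ k, 0 ≤ k → k ≤ n → -(2 * g) < X k) :
    g ≤ ((Finset.Ioc 0 N).filter fun k => ∃ u, G.Reachable (k, 0) u ∧ u.1 < k - n).card := by
  have key : ∀ l ∈ Finset.Ico (-(2 * g) : ℤ) (-g), ∃ k,
      k ∈ ((Finset.Ioc 0 N).filter fun k => ∃ u, G.Reachable (k, 0) u ∧ u.1 < k - n) ∧
        vertexLevel X Y (k, 0) = l := by
    intro l hl
    rw [Finset.mem_Ico] at hl
    obtain ⟨C, F, hF, h0, hbox, hlev⟩ := h.exists_contour (l := l) (n := 0) (m := 0)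
      (fun n hn hn' => by have := hr.hor n hn hn'; omega)
      (fun n hn hn' => by have := hr.vert n hn hn'; omega) ⟨ha₁, ha₂⟩ ⟨hb₁, hb₂⟩
      (by rw [h.zero_left, h.zero_right]; omega)
    obtain ⟨⟨k, hk, hkC⟩, j, hj, hjC⟩ := hF.exists_vertEdge h0
    have hkl := hlev _ hkC.1
    have hkl' := (h.level_up hkC.2).1
    rw [h.zero_right] at hkl'
    have hka := (hbox hkC.1).1.2
    simp only at hka
    have hnk : n < k := by
      by_contra hc
      have := hn k hk.le (by omega)
      omega
    refine ⟨k, ?_, hkl⟩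
    rw [Finset.mem_filter, Finset.mem_Ioc]
    exact ⟨⟨hk, by omega⟩, (j, 0), C.reachable_of_mem_supp hkC.1 hjC.1, by simp only; omega⟩
  choose! f hf hfl using key
  calc g = (Finset.Ico (-(2 * g) : ℤ) (-g)).card := by rw [Int.card_Ico]; omega
    _ ≤ _ := Finset.card_le_card_of_injOn f hf fun l hl l' hl' hll => by
        rw [← hfl l hl, ← hfl l' hl', hll]

end Encodes

/-- The position at time `k` of the one-sided walk with steps `t 0, t 1, …` started at `0`. -/
def partialSum (t : ℕ → ℤ) (k : ℕ) : ℤ := ∑ i ∈ Finset.range k, t i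

/-- The walk with steps `t`, started at `x`, reaches `(-∞, -a]` within `N` steps, and before it reaches
`[b, ∞)`. -/
def HitsBefore (a b : ℤ) (N : ℕ) (x : ℤ) (t : ℕ → ℤ) : Prop :=
  ∃ k ≤ N, x + partialSum t k ≤ -a ∧ ∀ j ≤ k, x + partialSum t j < b

/-- The steps of the four one-sided walks that make up the walks of `ξ` and `η`.  The first component
of `w` says which of the two walks is meant, the second one whether its right or its left half. -/
def arm (ξ η : ℤ → ℤˣ) (w : Bool × Bool) (j : ℕ) : ℤ :=
  if w.2 then step (if w.1 then ξ else η) (j + 1) else -step (if w.1 then ξ else η) (-j)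

lemma partialSum_arm_true (ξ η : ℤ → ℤˣ) (b : Bool) (k : ℕ) :
    partialSum (arm ξ η (b, true)) k = walk (step (if b then ξ else η)) k := by
  simp [partialSum, arm, walk_natCast]

lemma partialSum_arm_false (ξ η : ℤ → ℤˣ) (b : Bool) (k : ℕ) :
    partialSum (arm ξ η (b, false)) k = walk (step (if b then ξ else η)) (-k) := by
  simp [partialSum, arm, walk_neg_natCast]

lemma arm_eq (ξ η : ℤ → ℤˣ) (w : Bool × Bool) (j : ℕ) : arm ξ η w j = 1 ∨ arm ξ η w j = -1 := by
  unfold arm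
  split_ifs
  · exact step_eq _ _
  · exact step_eq _ _
  · rcases step_eq ξ (-j) with h | h <;> simp [h]
  · rcases step_eq η (-j) with h | h <;> simp [h]

lemma ringLE_of_arms {ξ η : ℤ → ℤˣ} {K : Bool × Bool → ℕ} {α β : ℤ}
    (h1 : ∀ w, partialSum (arm ξ η w) (K w) ≤ -α)
    (h2 : ∀ w, ∀ j ≤ K w, partialSum (arm ξ η w) j ≤ β) :
    RingLE (walk (step ξ)) (walk (step η)) (β - α) (-K (true, false)) (K (true, true))
      (-K (false, false)) (K (false, true)) := by
  have main : ∀ b, ∀ n : ℤ, -K (b, false) ≤ n → n ≤ K (b, true) →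
      walk (step (if b then ξ else η)) n ≤ β := by
    intro b n hn hn'
    obtain ⟨n, rfl | rfl⟩ := n.eq_nat_or_neg
    · rw [← partialSum_arm_true]
      exact h2 _ _ (by omega)
    · rw [← partialSum_arm_false]
      exact h2 _ _ (by omega)
  have e1 := h1 (true, false)
  have e2 := h1 (true, true)
  have e3 := h1 (false, false)
  have e4 := h1 (false, true)
  rw [partialSum_arm_false] at e1 e3
  rw [partialSum_arm_true] at e2 e4
  have m1 := main true
  have m2 := main false
  simp only [if_true, Bool.false_eq_true, if_false] at *
  exact ⟨fun n hn hn' => ⟨by linarith [m1 n hn hn'], by linarith [m1 n hn hn']⟩,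
    fun m hm hm' => ⟨by linarith [m2 m hm hm'], by linarith [m2 m hm hm']⟩⟩

lemma partialSum_add (t : ℕ → ℤ) (M k : ℕ) :
    partialSum t (M + k) = partialSum t M + partialSum (fun i => t (M + i)) k :=
  Finset.sum_range_add _ _ _

lemma abs_partialSum_le {t : ℕ → ℤ} (ht : ∀ i, t i = 1 ∨ t i = -1) (k : ℕ) :
    |partialSum t k| ≤ k := by
  refine (Finset.abs_sum_le_sum_abs _ _).trans ?_
  have : ∀ i ∈ Finset.range k, |t i| = 1 := fun i _ => by
    rcases ht i with h | h <;> simp [h]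
  rw [Finset.sum_congr rfl this]
  simp

/-- If each of the four one-sided walks falls by `6 * M` after time `M` before it rises by `2 * M`, then
there is a low ring: whatever the walks do up to time `M`, they end at most at `-5 * M`, and they
never exceed `3 * M`. -/
lemma hasLowRing_of_blocks {ξ η : ℤ → ℤˣ} {M N : ℕ}
    (hw : ∀ w, HitsBefore (6 * M) (2 * M) N 0 fun i => arm ξ η w (M + i)) {R : ℤ} (hR : R ≤ M) :
    HasLowRing (walk (step ξ)) (walk (step η)) R := by
  choose k _ hk2 hk3 using hw
  have hM : ∀ w, ∀ j ≤ M, |partialSum (arm ξ η w) j| ≤ M := fun w j hj =>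
    (abs_partialSum_le (arm_eq ξ η w) j).trans (by exact_mod_cast hj)
  have hr := ringLE_of_arms (ξ := ξ) (η := η) (K := fun w => M + k w) (α := 5 * M) (β := 3 * M)
    (fun w => by
      have e1 := (abs_le.1 (hM w M le_rfl))
      have e2 := hk2 w
      rw [partialSum_add]
      omega)
    (fun w j hj => by
      rcases le_total j M with h | h
      · have e1 := (abs_le.1 (hM w j h))
        omega
      · obtain ⟨i, rfl⟩ := Nat.exists_eq_add_of_le h
        have e1 := (abs_le.1 (hM w M le_rfl))
        have e2 := hk3 w i (by omega)
        rw [partialSum_add]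
        omega)
  refine ⟨_, _, _, _, ?_, ?_, ?_, ?_, hr.mono ?_⟩
  all_goals push_cast; omega

open Classical in
lemma le_card_long_of_arms {ξ η : ℤ → ℤˣ} {g n N : ℕ}
    (hw : ∀ w, HitsBefore (6 * g) (2 * g) N 0 (arm ξ η w))
    (hn : ∀ k ≤ n, |partialSum (arm ξ η (true, true)) k| < 2 * g) :
    g ≤ ((Finset.Ioc (0 : ℤ) N).filter fun k =>
      ∃ u, (graph ξ η).Reachable (k, 0) u ∧ u.1 < k - n).card := by
  choose k hk1 hk2 hk3 using hw
  have hr := ringLE_of_arms (ξ := ξ) (η := η) (K := k) (α := 6 * g) (β := 2 * g)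
    (fun w => by simpa using hk2 w) (fun w j hj => by simpa using (hk3 w j hj).le)
  rw [show (2 * g - 6 * g : ℤ) = -(4 * g) by ring] at hr
  refine (encodes_graph ξ η).le_card_long hr (by simp) (by simp) (by simp) (by simp)
    (by exact_mod_cast hk1 _) fun j hj0 hj => ?_
  obtain ⟨j, rfl⟩ := Int.eq_ofNat_of_zero_le hj0
  have := (abs_lt.1 (hn j (by omega))).1
  rwa [partialSum_arm_true] at this

end CornerPercolation

/-! ### Independent fair signs and estimates for the simple random walk -/

namespace CornerPercolation

variable {Ω Ω' ι κ : Type*} [MeasurableSpace Ω] [MeasurableSpace Ω'] {μ : Measure Ω}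

/-- The `s i` are independent fair signs, with values in `ℤ`. -/
structure IsFair (μ : Measure Ω) (s : ι → Ω → ℤ) : Prop where
  measurable : ∀ i, Measurable (s i)
  eq_or : ∀ i ω, s i ω = 1 ∨ s i ω = -1
  fair : ∀ i, μ {ω | s i ω = 1} = 1 / 2 ∧ μ {ω | s i ω = -1} = 1 / 2
  indep : iIndepFun s μ

namespace IsFair

variable {s : ι → Ω → ℤ}

lemma precomp (hs : IsFair μ s) {e : κ → ι} (he : Function.Injective e) :
    IsFair μ fun k => s (e k) :=
  ⟨fun _ => hs.measurable _, fun _ => hs.eq_or _, fun _ => hs.fair _, hs.indep.precomp he⟩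

lemma signs (hs : IsFair μ s) {c : ι → ℤ} (hc : ∀ i, c i = 1 ∨ c i = -1) :
    IsFair μ fun i ω => c i * s i ω := by
  refine ⟨fun i => (hs.measurable i).const_mul _, fun i ω => ?_, fun i => ?_,
    hs.indep.comp (fun i z => c i * z) fun i => measurable_from_top⟩
  · rcases hc i with h | h <;> rcases hs.eq_or i ω with h' | h' <;> simp [h, h']
  · rcases hc i with h | h
    · simpa [h] using hs.fair i
    · simpa [h, neg_eq_iff_eq_neg] using (hs.fair i).symm

/-- Any two families of independent fair signs with the same index set have the same law. -/
lemma map_eq [IsProbabilityMeasure μ] {ν : Measure Ω'} {t : ι → Ω' → ℤ} (hs : IsFair μ s)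
    (ht : IsFair ν t) : μ.map (fun ω i => s i ω) = ν.map (fun ω i => t i ω) := by
  rw [hs.indep.map_fun_eq_infinitePi_map hs.measurable,
    ht.indep.map_fun_eq_infinitePi_map ht.measurable]
  congr 1
  ext1 i
  refine Measure.ext_of_singleton fun z => ?_
  rw [Measure.map_apply (hs.measurable i) (measurableSet_singleton z),
    Measure.map_apply (ht.measurable i) (measurableSet_singleton z)]
  by_cases h1 : z = 1
  · subst h1
    exact (hs.fair i).1.trans (ht.fair i).1.symm
  by_cases h2 : z = -1
  · subst h2
    exact (hs.fair i).2.trans (ht.fair i).2.symm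
  have e1 : s i ⁻¹' {z} = ∅ := by
    ext ω
    have := hs.eq_or i ω
    simp only [Set.mem_preimage, Set.mem_singleton_iff, Set.mem_empty_iff_false,
      iff_false]
    omega
  have e2 : t i ⁻¹' {z} = ∅ := by
    ext ω
    have := ht.eq_or i ω
    simp only [Set.mem_preimage, Set.mem_singleton_iff, Set.mem_empty_iff_false,
      iff_false]
    omega
  rw [e1, e2, measure_empty, measure_empty]

lemma measure_eq [IsProbabilityMeasure μ] {ν : Measure Ω'} {t : ι → Ω' → ℤ} (hs : IsFair μ s)
    (ht : IsFair ν t) {A : Set (ι → ℤ)} (hA : MeasurableSet A) :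
    μ {ω | (fun i => s i ω) ∈ A} = ν {ω | (fun i => t i ω) ∈ A} := by
  have := congrArg (fun m : Measure (ι → ℤ) => m A) (hs.map_eq ht)
  rwa [Measure.map_apply (measurable_pi_iff.2 hs.measurable) hA,
    Measure.map_apply (measurable_pi_iff.2 ht.measurable) hA] at this

end IsFair

/-- Disjoint groups of independent variables are independent. -/
lemma iIndepFun_curry [IsProbabilityMeasure μ] {ι : Type*} {κ : ι → Type*}
    {s : (i : ι) → κ i → Ω → ℤ} (hm : ∀ i j, Measurable (s i j))
    (hs : iIndepFun (fun p : Σ i, κ i => s p.1 p.2) μ) :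
    iIndepFun (fun i ω j => s i j ω) μ := by
  have hm' : ∀ i, Measurable fun ω j => s i j ω := fun i => measurable_pi_iff.2 (hm i)
  rw [iIndepFun_iff_map_fun_eq_infinitePi_map hm']
  have h1 := hs.map_fun_eq_infinitePi_map fun p : Σ i, κ i => hm p.1 p.2
  have : ∀ i j, IsProbabilityMeasure (μ.map (s i j)) := fun i j =>
    Measure.isProbabilityMeasure_map (hm i j).aemeasurable
  have h2 := Measure.infinitePi_map_piCurry (fun i j => μ.map (s i j))
  rw [← h1, Measure.map_map (by fun_prop) (measurable_pi_iff.2 fun p : Σ i, κ i => hm p.1 p.2)] at h2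
  have h3 : ∀ i, μ.map (fun ω j => s i j ω) = Measure.infinitePi fun j => μ.map (s i j) :=
    fun i => (hs.precomp (g := fun j : κ i => (⟨i, j⟩ : Σ i, κ i))
      sigma_mk_injective).map_fun_eq_infinitePi_map (hm i)
  simp_rw [h3]
  exact h2

/-- Conditioning on the first sign. -/
lemma IsFair.first_step [IsProbabilityMeasure μ] {s : ℕ → Ω → ℤ} (hs : IsFair μ s)
    {A : ℤ → Set (ℕ → ℤ)} (hA : ∀ z, MeasurableSet (A z)) :
    μ.real {ω | (fun j => s (j + 1) ω) ∈ A (s 0 ω)} =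
      (μ.real {ω | (fun j => s (j + 1) ω) ∈ A 1} + μ.real {ω | (fun j => s (j + 1) ω) ∈ A (-1)}) / 2 := by
  have hm : Measurable fun ω j => s (j + 1) ω := measurable_pi_iff.2 fun j => hs.measurable _
  have hind : IndepFun (s 0) (fun ω j => s (j + 1) ω) μ := by
    have h1 := iIndepFun_curry (μ := μ) (ι := Bool) (κ := fun b => {j : ℕ // decide (j = 0) = b})
      (s := fun b j => s j) (fun b j => hs.measurable _)
      (hs.indep.precomp (g := fun p : Σ b : Bool, {j : ℕ // decide (j = 0) = b} => (p.2 : ℕ))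
        (by
          rintro ⟨b, j, rfl⟩ ⟨c, k, rfl⟩ h
          obtain rfl : j = k := h
          rfl))
    have hφ : Measurable fun f : {j : ℕ // decide (j = 0) = true} → ℤ => f ⟨0, by simp⟩ :=
      measurable_pi_apply _
    have hψ : Measurable fun (f : {j : ℕ // decide (j = 0) = false} → ℤ) (j : ℕ) =>
        f ⟨j + 1, by simp⟩ := measurable_pi_iff.2 fun j => measurable_pi_apply _
    have h2 := (h1.indepFun (i := true) (j := false) (by decide)).comp hφ hψ
    exact h2
  have hsplit : {ω | (fun j => s (j + 1) ω) ∈ A (s 0 ω)} =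
      (s 0 ⁻¹' {1} ∩ (fun ω j => s (j + 1) ω) ⁻¹' A 1) ∪
        (s 0 ⁻¹' {-1} ∩ (fun ω j => s (j + 1) ω) ⁻¹' A (-1)) := by
    ext ω
    rcases hs.eq_or 0 ω with h | h <;> simp [h]
  have h1 : μ.real (s 0 ⁻¹' {1}) = 1 / 2 := by
    have := (hs.fair 0).1
    rw [measureReal_def, show s 0 ⁻¹' {1} = {ω | s 0 ω = 1} from rfl, this]
    simp
  have h2 : μ.real (s 0 ⁻¹' {-1}) = 1 / 2 := by
    have := (hs.fair 0).2
    rw [measureReal_def, show s 0 ⁻¹' {-1} = {ω | s 0 ω = -1} from rfl, this]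
    simp
  have h3 : ∀ z, μ.real (s 0 ⁻¹' {z} ∩ (fun ω j => s (j + 1) ω) ⁻¹' A z) =
      μ.real (s 0 ⁻¹' {z}) * μ.real ((fun ω j => s (j + 1) ω) ⁻¹' A z) := by
    intro z
    rw [measureReal_def, hind.measure_inter_preimage_eq_mul _ _ (measurableSet_singleton z) (hA z),
      ENNReal.toReal_mul]
    rfl
  rw [hsplit, measureReal_union, h3, h3, h1, h2]
  · simp only [Set.preimage]
    ring
  · rw [Set.disjoint_left]
    rintro ω ⟨h, -⟩ ⟨h', -⟩
    simp only [Set.mem_preimage, Set.mem_singleton_iff] at h h'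
    omega
  · exact (hs.measurable 0 (measurableSet_singleton _)).inter (hm (hA _))

/-- The walk with steps `t`, started at `x`, stays in `(-a, b)` up to time `N`. -/
def Stays (a b : ℤ) (N : ℕ) (x : ℤ) (t : ℕ → ℤ) : Prop :=
  ∀ k ≤ N, -a < x + partialSum t k ∧ x + partialSum t k < b

/-- The walk with steps `t`, started at `x`, leaves `(-h, h)` by time `n`. -/
def Exits (h : ℤ) (n : ℕ) (x : ℤ) (t : ℕ → ℤ) : Prop :=
  ∃ k ≤ n, h ≤ |x + partialSum t k|

lemma measurable_partialSum (k : ℕ) : Measurable fun t => partialSum t k :=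
  Finset.measurable_sum _ fun i _ => measurable_pi_apply i

lemma measurableSet_hitsBefore (a b : ℤ) (N : ℕ) (x : ℤ) :
    MeasurableSet {t | HitsBefore a b N x t} := by
  have h (k : ℕ) := (measurable_partialSum k).const_add x
  exact measurableSet_setOfPred.2 (.exists fun k => measurable_const.and
    ((measurableSet_setOfPred.1 (measurableSet_le (h k) measurable_const)).and
      (.forall fun j => measurable_const.imp
        (measurableSet_setOfPred.1 (measurableSet_lt (h j) measurable_const)))))

lemma measurableSet_stays (a b : ℤ) (N : ℕ) (x : ℤ) : MeasurableSet {t | Stays a b N x t} := by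
  have h (k : ℕ) := (measurable_partialSum k).const_add x
  exact measurableSet_setOfPred.2 (.forall fun k => measurable_const.imp
    ((measurableSet_setOfPred.1 (measurableSet_lt measurable_const (h k))).and
      (measurableSet_setOfPred.1 (measurableSet_lt (h k) measurable_const))))

lemma measurableSet_exits (a : ℤ) (n : ℕ) (x : ℤ) : MeasurableSet {t | Exits a n x t} := by
  have h (k : ℕ) := (measurable_partialSum k).const_add x
  have h' (k : ℕ) : Measurable fun t => |x + partialSum t k| :=
    (measurable_from_top (f := fun z : ℤ => |z|)).comp (h k)
  exact measurableSet_setOfPred.2 (.exists fun k => measurable_const.and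
    (measurableSet_setOfPred.1 (measurableSet_le measurable_const (h' k))))

lemma partialSum_zero (t : ℕ → ℤ) : partialSum t 0 = 0 := rfl

lemma partialSum_succ (t : ℕ → ℤ) (k : ℕ) :
    partialSum t (k + 1) = t 0 + partialSum (fun j => t (j + 1)) k := by
  rw [partialSum, Finset.sum_range_succ', add_comm]
  rfl

lemma Stays.tail {a b : ℤ} {N : ℕ} {x : ℤ} {t : ℕ → ℤ} (h : Stays a b (N + 1) x t) :
    Stays a b N (x + t 0) fun j => t (j + 1) := fun k hk => by
  have := h (k + 1) (by omega)
  rwa [partialSum_succ, ← add_assoc] at this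

lemma stays_succ {a b : ℤ} {N : ℕ} {x : ℤ} {t : ℕ → ℤ} (hx : -a < x ∧ x < b)
    (h : Stays a b N (x + t 0) fun j => t (j + 1)) : Stays a b (N + 1) x t := by
  rintro (_ | k) hk
  · simpa [partialSum_zero] using hx
  · rw [partialSum_succ, ← add_assoc]
    exact h k (by omega)

lemma hitsBefore_succ {a b : ℤ} {N : ℕ} {x : ℤ} {t : ℕ → ℤ} (hx : x < b)
    (h : HitsBefore a b N (x + t 0) fun j => t (j + 1)) : HitsBefore a b (N + 1) x t := by
  obtain ⟨k, hk, h1, h2⟩ := h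
  refine ⟨k + 1, by omega, by rwa [partialSum_succ, ← add_assoc], ?_⟩
  rintro (_ | j) hj
  · simpa [partialSum_zero] using hx
  · rw [partialSum_succ, ← add_assoc]
    exact h2 j (by omega)

lemma hitsBefore_of_le {a b : ℤ} {N : ℕ} {x : ℤ} {t : ℕ → ℤ} (ha : x ≤ -a) (hb : x < b) :
    HitsBefore a b N x t := by
  refine ⟨0, by omega, by simpa [partialSum_zero] using ha, fun j hj => ?_⟩
  obtain rfl : j = 0 := by omega
  simpa [partialSum_zero] using hb

lemma Exits.tail {h : ℤ} {n : ℕ} {x : ℤ} {t : ℕ → ℤ} (hx : |x| < h) (he : Exits h (n + 1) x t) :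
    Exits h n (x + t 0) fun j => t (j + 1) := by
  obtain ⟨_ | k, hk, he⟩ := he
  · rw [partialSum_zero, add_zero] at he
    omega
  · rw [partialSum_succ, ← add_assoc] at he
    exact ⟨k, by omega, he⟩

section Estimates

variable [IsProbabilityMeasure μ]

omit [IsProbabilityMeasure μ] in
lemma IsFair.tail {s : ℕ → Ω → ℤ} (hs : IsFair μ s) : IsFair μ fun j => s (j + 1) :=
  hs.precomp (add_left_injective 1)

/-- The expected time to leave `(-a, b)` from `x` is `(b - x) * (x + a)`, which bounds the probability
of staying for `N` steps. -/
lemma mul_prob_stays_le {s : ℕ → Ω → ℤ} (hs : IsFair μ s) {a b x : ℤ} (ha : -a ≤ x) (hb : x ≤ b)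
    (N : ℕ) : N * μ.real {ω | Stays a b N x fun j => s j ω} ≤ (b - x) * (x + a) := by
  have ha' : (0 : ℝ) ≤ x + a := by exact_mod_cast (by omega : 0 ≤ x + a)
  have hb' : (0 : ℝ) ≤ b - x := by exact_mod_cast (by omega : 0 ≤ b - x)
  induction N generalizing x s with
  | zero =>
    rw [Nat.cast_zero, zero_mul]
    exact mul_nonneg hb' ha'
  | succ N ih =>
    by_cases hx : -a < x ∧ x < b
    · have h1 : μ.real {ω | Stays a b (N + 1) x fun j => s j ω} ≤
          μ.real {ω | (fun j => s (j + 1) ω) ∈ {t | Stays a b N (x + s 0 ω) t}} :=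
        measureReal_mono fun ω hω => hω.tail
      rw [hs.first_step (A := fun z => {t | Stays a b N (x + z) t})
        fun z => measurableSet_stays _ _ _ _] at h1
      have h2 : μ.real {ω | Stays a b (N + 1) x fun j => s j ω} ≤ 1 := measureReal_le_one
      have h3 := ih hs.tail (x := x + 1) (by omega) (by omega)
        (by exact_mod_cast (by omega : 0 ≤ x + 1 + a)) (by exact_mod_cast (by omega : 0 ≤ b - (x + 1)))
      have h4 := ih hs.tail (x := x + -1) (by omega) (by omega)
        (by exact_mod_cast (by omega : 0 ≤ x + -1 + a)) (by exact_mod_cast (by omega : 0 ≤ b - (x + -1)))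
      simp only [Set.mem_ofPred_eq] at h1
      push_cast at h3 h4 ⊢
      have h5 := mul_le_mul_of_nonneg_left h1 (Nat.cast_nonneg (α := ℝ) N)
      nlinarith
    · have : {ω | Stays a b (N + 1) x fun j => s j ω} = ∅ := by
        ext ω
        simp only [Set.mem_ofPred_eq, Set.mem_empty_iff_false, iff_false]
        intro h
        have := h 0 (by omega)
        rw [partialSum_zero] at this
        omega
      rw [this, measureReal_empty, mul_zero]
      exact mul_nonneg hb' ha'

/-- The gambler's ruin estimate with a time horizon: `(b - x) / (a + b)` is harmonic in `x`, and it is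
at most the probability of having reached `-a` first or being undecided. -/
lemma le_mul_prob_hitsBefore_add {s : ℕ → Ω → ℤ} (hs : IsFair μ s) {a b x : ℤ} (hab : 0 < a + b)
    (ha : -a ≤ x) (hb : x ≤ b) (N : ℕ) :
    (b - x : ℝ) ≤ (a + b) * (μ.real {ω | HitsBefore a b N x fun j => s j ω} +
      μ.real {ω | Stays a b N x fun j => s j ω}) := by
  have hab' : (0 : ℝ) < a + b := by exact_mod_cast hab
  induction N generalizing x s with
  | zero =>
    have hxa : (-a : ℝ) ≤ x := by exact_mod_cast ha
    have h0 : 0 ≤ μ.real {ω | HitsBefore a b 0 x fun j => s j ω} := measureReal_nonneg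
    have h1 : 0 ≤ μ.real {ω | Stays a b 0 x fun j => s j ω} := measureReal_nonneg
    rcases hb.eq_or_lt with rfl | hb
    · rw [sub_self]
      positivity
    rcases ha.eq_or_lt with rfl | ha
    · have : {ω | HitsBefore a b 0 (-a) fun j => s j ω} = Set.univ :=
        Set.eq_univ_of_forall fun ω => hitsBefore_of_le le_rfl hb
      rw [this, probReal_univ]
      push_cast
      nlinarith
    · have : {ω | Stays a b 0 x fun j => s j ω} = Set.univ := by
        refine Set.eq_univ_of_forall fun ω j hj => ?_
        obtain rfl : j = 0 := by omega
        simpa [partialSum_zero] using ⟨ha, hb⟩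
      rw [this, probReal_univ]
      nlinarith
  | succ N ih =>
    have h1 : 0 ≤ μ.real {ω | Stays a b (N + 1) x fun j => s j ω} := measureReal_nonneg
    rcases hb.eq_or_lt with rfl | hb
    · rw [sub_self]
      positivity
    rcases ha.eq_or_lt with rfl | ha
    · have : {ω | HitsBefore a b (N + 1) (-a) fun j => s j ω} = Set.univ :=
        Set.eq_univ_of_forall fun ω => hitsBefore_of_le le_rfl hb
      rw [this, probReal_univ]
      push_cast
      nlinarith
    have h2 : μ.real {ω | (fun j => s (j + 1) ω) ∈ {t | Stays a b N (x + s 0 ω) t}} ≤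
        μ.real {ω | Stays a b (N + 1) x fun j => s j ω} :=
      measureReal_mono fun ω hω => stays_succ ⟨ha, hb⟩ hω
    rw [hs.first_step (A := fun z => {t | Stays a b N (x + z) t})
      fun z => measurableSet_stays _ _ _ _] at h2
    have h3 : μ.real {ω | (fun j => s (j + 1) ω) ∈ {t | HitsBefore a b N (x + s 0 ω) t}} ≤
        μ.real {ω | HitsBefore a b (N + 1) x fun j => s j ω} :=
      measureReal_mono fun ω hω => hitsBefore_succ hb hω
    rw [hs.first_step (A := fun z => {t | HitsBefore a b N (x + z) t})
      fun z => measurableSet_hitsBefore _ _ _ _] at h3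
    have h4 := ih hs.tail (x := x + 1) (by omega) (by omega)
    have h5 := ih hs.tail (x := x + -1) (by omega) (by omega)
    simp only [Set.mem_ofPred_eq] at h2 h3
    push_cast at h4 h5
    nlinarith

/-- Kolmogorov's maximal inequality for the walk started at `x`. -/
lemma sq_mul_prob_exits_le {s : ℕ → Ω → ℤ} (hs : IsFair μ s) {h : ℤ} (hh : 0 ≤ h) (x : ℤ) (n : ℕ) :
    (h : ℝ) ^ 2 * μ.real {ω | Exits h n x fun j => s j ω} ≤ n + x ^ 2 := by
  have far : ∀ (x : ℤ) (n : ℕ) (s : ℕ → Ω → ℤ), h ≤ |x| →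
      (h : ℝ) ^ 2 * μ.real {ω | Exits h n x fun j => s j ω} ≤ n + x ^ 2 := by
    intro x n s hx
    have h1 : μ.real {ω | Exits h n x fun j => s j ω} ≤ 1 := measureReal_le_one
    have h2 : (h : ℝ) ^ 2 ≤ x ^ 2 := by
      rw [← sq_abs (x : ℝ)]
      exact pow_le_pow_left₀ (by exact_mod_cast hh) (by exact_mod_cast hx) 2
    have h3 : (0 : ℝ) ≤ n := n.cast_nonneg
    nlinarith [sq_nonneg (h : ℝ)]
  induction n generalizing x s with
  | zero =>
    rcases le_or_gt h |x| with hx | hx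
    · exact far x 0 s hx
    · have : {ω | Exits h 0 x fun j => s j ω} = ∅ := by
        refine Set.eq_empty_of_forall_notMem ?_
        rintro ω ⟨k, hk, hk'⟩
        obtain rfl : k = 0 := by omega
        rw [partialSum_zero, add_zero] at hk'
        omega
      rw [this, measureReal_empty, mul_zero]
      positivity
  | succ n ih =>
    rcases le_or_gt h |x| with hx | hx
    · exact far x _ s hx
    · have h1 : μ.real {ω | Exits h (n + 1) x fun j => s j ω} ≤
          μ.real {ω | (fun j => s (j + 1) ω) ∈ {t | Exits h n (x + s 0 ω) t}} :=
        measureReal_mono fun ω hω => hω.tail hx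
      rw [hs.first_step (A := fun z => {t | Exits h n (x + z) t})
        fun z => measurableSet_exits _ _ _] at h1
      have h2 := ih hs.tail (x + 1)
      have h3 := ih hs.tail (x + -1)
      simp only [Set.mem_ofPred_eq] at h1
      push_cast at h2 h3 ⊢
      nlinarith [mul_le_mul_of_nonneg_left h1 (sq_nonneg (h : ℝ))]

/-- With `192 * g ^ 2` steps, the walk hits `-6 * g` before `2 * g` with probability at least
`1/4 - 1/16`, and by time `n ≤ g ^ 2 / 4` it leaves `(-2 * g, 2 * g)` with probability at most `1/16`. -/
lemma le_prob_hitsBefore_not_exits {s : ℕ → Ω → ℤ} (hs : IsFair μ s) {g n : ℕ} (hg : 0 < g)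
    (hn : 4 * n ≤ g ^ 2) :
    1 / 8 ≤ μ.real {ω | HitsBefore (6 * g) (2 * g) (192 * g ^ 2) 0 (fun j => s j ω) ∧
      ¬ Exits (2 * g) n 0 fun j => s j ω} := by
  have hg' : (0 : ℝ) < g := by exact_mod_cast hg
  have hn' : (4 * n : ℝ) ≤ g ^ 2 := by exact_mod_cast hn
  have h1 := mul_prob_stays_le hs (a := 6 * g) (b := 2 * g) (x := 0) (by omega) (by omega)
    (192 * g ^ 2)
  have h2 := le_mul_prob_hitsBefore_add hs (a := 6 * g) (b := 2 * g) (x := 0) (by omega) (by omega)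
    (by omega) (192 * g ^ 2)
  have h3 := sq_mul_prob_exits_le hs (h := 2 * g) (by omega) 0 n
  have h4 : μ.real {ω | HitsBefore (6 * g) (2 * g) (192 * g ^ 2) 0 (fun j => s j ω)} ≤
      μ.real {ω | HitsBefore (6 * g) (2 * g) (192 * g ^ 2) 0 (fun j => s j ω) ∧
        ¬ Exits (2 * g) n 0 fun j => s j ω} + μ.real {ω | Exits (2 * g) n 0 fun j => s j ω} := by
    refine (measureReal_mono fun ω hω => ?_).trans (measureReal_union_le _ _)
    by_cases he : Exits (2 * g) n 0 fun j => s j ω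
    · exact Or.inr he
    · exact Or.inl ⟨hω, he⟩
  set p := μ.real {ω | Stays (6 * g) (2 * g) (192 * g ^ 2) 0 fun j => s j ω}
  set q := μ.real {ω | HitsBefore (6 * g) (2 * g) (192 * g ^ 2) 0 fun j => s j ω}
  set r := μ.real {ω | Exits (2 * g) n 0 fun j => s j ω}
  push_cast at h1 h2 h3
  have e1 : p ≤ 1 / 16 := by
    have : (192 * g ^ 2 : ℝ) * p ≤ 192 * g ^ 2 * (1 / 16) := by nlinarith
    exact le_of_mul_le_mul_left this (by positivity)
  have e2 : 1 / 4 ≤ q + p := by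
    have : (8 * g : ℝ) * (1 / 4) ≤ 8 * g * (q + p) := by nlinarith
    exact le_of_mul_le_mul_left this (by positivity)
  have e3 : r ≤ 1 / 16 := by
    have : (4 * g ^ 2 : ℝ) * r ≤ 4 * g ^ 2 * (1 / 16) := by nlinarith
    exact le_of_mul_le_mul_left this (by positivity)
  linarith

end Estimates

end CornerPercolation

/-! ### Almost sure existence of rings -/

namespace CornerPercolation

variable {Ω : Type*} [MeasurableSpace Ω] {μ : Measure Ω} {ξ η : ℤ → Ω → ℤˣ}

lemma measurable_comp_sign {x : Ω → ℤˣ} (hx : ∀ s, MeasurableSet {ω | x ω = s}) (g : ℤˣ → ℤ) :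
    Measurable fun ω => g (x ω) := by
  have : (fun ω => g (x ω)) = fun ω => if x ω = 1 then g 1 else g (-1) := by
    ext ω
    rcases Int.units_eq_one_or (x ω) with h | h <;> simp [h]
  rw [this]
  exact Measurable.ite (hx 1) measurable_const measurable_const

/-- The steps of the two walks, as one family. -/
def jointSteps (ξ η : ℤ → ℤˣ) : ℤ ⊕ ℤ → ℤ := Sum.elim (step ξ) (step η)

lemma step_eq_one_iff (ξ : ℤ → ℤˣ) (n : ℤ) : step ξ n = 1 ↔ ξ n = -n.negOnePow := by
  rcases Int.units_eq_one_or (ξ n) with h | h <;>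
    rcases Int.units_eq_one_or n.negOnePow with h' | h' <;> simp [step, h, h']

lemma step_eq_neg_one_iff (ξ : ℤ → ℤˣ) (n : ℤ) : step ξ n = -1 ↔ ξ n = n.negOnePow := by
  rcases Int.units_eq_one_or (ξ n) with h | h <;>
    rcases Int.units_eq_one_or n.negOnePow with h' | h' <;> simp [step, h, h']

namespace IsFairSigns

lemma isFair_jointSteps (h : IsFairSigns μ ξ η) :
    IsFair μ fun i ω => jointSteps (ξ · ω) (η · ω) i := by
  let g : ℤ ⊕ ℤ → ℤˣ → ℤ := Sum.elim (fun n u => -((n.negOnePow * u : ℤˣ) : ℤ))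
    fun n u => -((n.negOnePow * u : ℤˣ) : ℤ)
  refine ⟨?_, ?_, ?_, ?_⟩
  · rintro (n | n)
    · exact measurable_comp_sign (h.measurable_left n) (g (Sum.inl n))
    · exact measurable_comp_sign (h.measurable_right n) (g (Sum.inr n))
  · rintro (n | n) ω
    · exact step_eq (ξ · ω) n
    · exact step_eq (η · ω) n
  · rintro (n | n)
    · simp only [jointSteps, Sum.elim_inl, step_eq_one_iff, step_eq_neg_one_iff]
      exact ⟨h.fair_left _ _, h.fair_left _ _⟩
    · simp only [jointSteps, Sum.elim_inr, step_eq_one_iff, step_eq_neg_one_iff]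
      exact ⟨h.fair_right _ _, h.fair_right _ _⟩
  · have := h.indep.comp g fun i => measurable_from_top
    convert this using 1
    ext (n | n) ω <;> rfl

/-- Fair signs stay fair if the first family is translated and each family is multiplied by a sign. -/
lemma transform (h : IsFairSigns μ ξ η) (k : ℤ) (c d : ℤˣ) :
    IsFairSigns μ (fun n ω => c * ξ (n + k) ω) (fun m ω => d * η m ω) := by
  have e : ∀ (c x s : ℤˣ), c * x = s ↔ x = c⁻¹ * s := fun c x s => by
    rw [eq_inv_mul_iff_mul_eq]
  refine ⟨fun n s => ?_, fun m s => ?_, fun n s => ?_, fun m s => ?_, ?_⟩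
  · simp only [e]
    exact h.measurable_left _ _
  · simp only [e]
    exact h.measurable_right _ _
  · simp only [e]
    exact h.fair_left _ _
  · simp only [e]
    exact h.fair_right _ _
  · have h1 := h.indep.precomp (g := Sum.map (· + k) id)
      (Sum.map_injective.2 ⟨add_left_injective k, Function.injective_id⟩)
    have h2 := h1.comp (mγ := fun _ => ⊤) (Sum.elim (fun _ u => c * u) fun _ u => d * u)
      fun i => @measurable_from_top _ _ ⊤ _
    convert h2 using 1
    ext (n | n) ω <;> rfl

lemma isFair_arm (h : IsFairSigns μ ξ η) :
    IsFair μ fun (p : (Bool × Bool) × ℕ) ω => arm (ξ · ω) (η · ω) p.1 p.2 := by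
  let e : (Bool × Bool) × ℕ → ℤ ⊕ ℤ := fun p =>
    let n : ℤ := if p.1.2 then p.2 + 1 else -p.2
    if p.1.1 then Sum.inl n else Sum.inr n
  have he : Function.Injective e := by
    rintro ⟨⟨a, b⟩, j⟩ ⟨⟨c, d⟩, k⟩ hjk
    cases a <;> cases b <;> cases c <;> cases d <;> simp [e] at hjk ⊢ <;> omega
  have := (h.isFair_jointSteps.precomp he).signs (c := fun p => if p.1.2 then 1 else -1)
    (fun p => by split_ifs <;> simp)
  convert this using 3 with p ω
  obtain ⟨⟨a, b⟩, j⟩ := p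
  cases a <;> cases b <;> simp [arm, e, jointSteps]

end IsFairSigns

/-- If the events `E (k, w)` are independent, then so are the events `⋂ w, E (k, w)`. -/
lemma iIndepSet_iInter {ι κ : Type*} [Fintype κ] {E : ι × κ → Set Ω}
    (hm : ∀ i, MeasurableSet (E i)) (hE : ∀ S : Finset (ι × κ), μ (⋂ i ∈ S, E i) = ∏ i ∈ S, μ (E i)) :
    iIndepSet (fun k => ⋂ w, E (k, w)) μ := by
  rw [iIndepSet_iff_meas_biInter fun k => MeasurableSet.iInter fun w => hm _]
  have h1 : ∀ S : Finset ι, (⋂ k ∈ S, ⋂ w, E (k, w)) = ⋂ i ∈ S ×ˢ (Finset.univ : Finset κ), E i := by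
    intro S
    ext ω
    simp only [Set.mem_iInter, Finset.mem_product, Finset.mem_univ, and_true, Prod.forall]
    exact ⟨fun h a b ha => h a ha b, fun h a ha b => h a b ha⟩
  have h2 : ∀ k, μ (⋂ w, E (k, w)) = ∏ w, μ (E (k, w)) := by
    intro k
    have := h1 {k}
    rw [Finset.set_biInter_singleton] at this
    rw [this, hE, Finset.prod_product, Finset.prod_singleton]
  intro S
  rw [h1, hE, Finset.prod_product]
  simp_rw [h2]

/-- A sequence of times that grows so fast that the block of steps from `scale k` to `scale (k + 1)`
is long enough for the event of `hasLowRing_of_blocks` with `M = scale k`. -/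
def scale : ℕ → ℕ
  | 0 => 1
  | k + 1 => scale k + 192 * scale k ^ 2

lemma scale_pos (k : ℕ) : 0 < scale k := by
  induction k with
  | zero => simp [scale]
  | succ k ih =>
    rw [scale]
    omega

lemma strictMono_scale : StrictMono scale := by
  refine strictMono_nat_of_lt_succ fun k => ?_
  rw [scale]
  have := scale_pos k
  have : 0 < 192 * scale k ^ 2 := by positivity
  omega

lemma hitsBefore_congr {a b : ℤ} {N : ℕ} {x : ℤ} {t t' : ℕ → ℤ} (h : ∀ i < N, t i = t' i) :
    HitsBefore a b N x t ↔ HitsBefore a b N x t' := by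
  have key : ∀ k ≤ N, partialSum t k = partialSum t' k := fun k hk =>
    Finset.sum_congr rfl fun i hi => h i (by rw [Finset.mem_range] at hi; omega)
  constructor
  · rintro ⟨k, hk, h1, h2⟩
    exact ⟨k, hk, by rwa [← key k hk], fun j hj => by rw [← key j (by omega)]; exact h2 j hj⟩
  · rintro ⟨k, hk, h1, h2⟩
    exact ⟨k, hk, by rwa [key k hk], fun j hj => by rw [key j (by omega)]; exact h2 j hj⟩

namespace IsFairSigns

variable [IsProbabilityMeasure μ]

/-- In the `k`-th block of steps, the one-sided walk `w` falls by `6 * scale k` before it rises by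
`2 * scale k`; here `i = (k, w)`. -/
def blockEvent (ξ η : ℤ → Ω → ℤˣ) (i : ℕ × (Bool × Bool)) : Set Ω :=
  {ω | HitsBefore (6 * scale i.1) (2 * scale i.1) (192 * scale i.1 ^ 2) 0
    fun j => arm (ξ · ω) (η · ω) i.2 (scale i.1 + j)}

omit [IsProbabilityMeasure μ] in
lemma measurableSet_blockEvent (h : IsFairSigns μ ξ η) (i : ℕ × (Bool × Bool)) :
    MeasurableSet (blockEvent ξ η i) :=
  (measurable_pi_iff.2 fun j => h.isFair_arm.measurable (i.2, scale i.1 + j))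
    (measurableSet_hitsBefore _ _ _ _)

lemma le_measure_blockEvent (h : IsFairSigns μ ξ η) (i : ℕ × (Bool × Bool)) :
    1 / 8 ≤ μ (blockEvent ξ η i) := by
  have h1 : IsFair μ fun j ω => arm (ξ · ω) (η · ω) i.2 (scale i.1 + j) :=
    h.isFair_arm.precomp (e := fun j => (i.2, scale i.1 + j)) fun j k hjk => by simpa using hjk
  have h2 := le_prob_hitsBefore_not_exits h1 (scale_pos i.1) (n := 0) (by simp)
  have h3 : (1 / 8 : ℝ) ≤ μ.real (blockEvent ξ η i) :=
    h2.trans (measureReal_mono fun ω hω => hω.1)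
  rw [measureReal_def, ← ENNReal.ofReal_le_iff_le_toReal (measure_ne_top _ _)] at h3
  refine le_trans (le_of_eq ?_) h3
  rw [ENNReal.ofReal_div_of_pos (by norm_num)]
  simp

lemma measure_biInter_blockEvent (h : IsFairSigns μ ξ η) (S : Finset (ℕ × (Bool × Bool))) :
    μ (⋂ i ∈ S, blockEvent ξ η i) = ∏ i ∈ S, μ (blockEvent ξ η i) := by
  let κ : ℕ × (Bool × Bool) → Type := fun i => Fin (192 * scale i.1 ^ 2)
  let e : (Σ i, κ i) → (Bool × Bool) × ℕ := fun p => (p.1.2, scale p.1.1 + p.2.1)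
  have hsc : ∀ k l (i : Fin (192 * scale k ^ 2)), k < l → scale k + i < scale l := by
    intro k l i hkl
    refine lt_of_lt_of_le ?_ (strictMono_scale.monotone hkl)
    rw [Nat.succ_eq_add_one, scale]
    omega
  have he : Function.Injective e := by
    rintro ⟨⟨k, w⟩, i⟩ ⟨⟨l, w'⟩, j⟩ hij
    simp only [e, Prod.mk.injEq] at hij
    obtain ⟨rfl, hij⟩ := hij
    rcases lt_trichotomy k l with hkl | rfl | hkl
    · have := hsc k l i hkl
      omega
    · have : i = j := Fin.ext (by omega)
      rw [this]
    · have := hsc l k j hkl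
      omega
  have hind := iIndepFun_curry (μ := μ) (κ := κ)
    (s := fun i j ω => arm (ξ · ω) (η · ω) i.2 (scale i.1 + j.1))
    (fun i j => h.isFair_arm.measurable (i.2, scale i.1 + j.1)) (h.isFair_arm.indep.precomp he)
  -- a block event only depends on the steps in its block
  let ext : (i : ℕ × (Bool × Bool)) → (κ i → ℤ) → ℕ → ℤ := fun i t j =>
    if hj : j < 192 * scale i.1 ^ 2 then t ⟨j, hj⟩ else 0
  have hext : ∀ i, Measurable (ext i) := by
    refine fun i => measurable_pi_iff.2 fun j => ?_
    by_cases hj : j < 192 * scale i.1 ^ 2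
    · simp only [ext, hj, dif_pos]
      exact measurable_pi_apply _
    · simp only [ext, hj, dif_neg, not_false_eq_true]
      exact measurable_const
  have hpre : ∀ i, blockEvent ξ η i =
      (fun ω (j : κ i) => arm (ξ · ω) (η · ω) i.2 (scale i.1 + j.1)) ⁻¹' (ext i ⁻¹'
        {t | HitsBefore (6 * scale i.1) (2 * scale i.1) (192 * scale i.1 ^ 2) 0 t}) := by
    intro i
    ext ω
    refine hitsBefore_congr fun j hj => ?_
    simp only [ext, hj, dif_pos]
  simp_rw [hpre]
  exact hind.measure_inter_preimage_eq_mul S fun i _ => hext i (measurableSet_hitsBefore _ _ _ _)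

/-- Almost surely there are low rings around all boxes, by the second Borel-Cantelli lemma for the
independent events that the four walks all behave well in the `k`-th block. -/
lemma ae_hasLowRing (h : IsFairSigns μ ξ η) :
    ∀ᵐ ω ∂μ, ∀ R, HasLowRing (walk (step (ξ · ω))) (walk (step (η · ω))) R := by
  have hm : ∀ k, MeasurableSet (⋂ w, blockEvent ξ η (k, w)) := fun k =>
    MeasurableSet.iInter fun w => h.measurableSet_blockEvent _
  have hind := iIndepSet_iInter h.measurableSet_blockEvent h.measure_biInter_blockEvent
  have hsum : ∑' k, μ (⋂ w, blockEvent ξ η (k, w)) = ∞ := by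
    rw [← top_le_iff, ← ENNReal.tsum_const_eq_top_of_ne_zero (α := ℕ)
      (c := ((1 / 8 : ℝ≥0∞) ^ 4)) (by simp)]
    refine ENNReal.tsum_le_tsum fun k => ?_
    have h1 : (⋂ w, blockEvent ξ η (k, w)) =
        ⋂ i ∈ ({k} : Finset ℕ) ×ˢ (Finset.univ : Finset (Bool × Bool)), blockEvent ξ η i := by
      ext ω
      simp only [Set.mem_iInter, Finset.mem_product, Finset.mem_singleton, Finset.mem_univ,
        and_true, Prod.forall]
      exact ⟨fun h l a b hl => hl ▸ h a b, fun h a b => h k a b rfl⟩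
    rw [h1, h.measure_biInter_blockEvent, Finset.prod_product, Finset.prod_singleton]
    calc (1 / 8 : ℝ≥0∞) ^ 4 = ∏ _w : Bool × Bool, 1 / 8 := by simp
      _ ≤ _ := Finset.prod_le_prod' fun w _ => h.le_measure_blockEvent _
  have hlim := measure_limsup_eq_one hm hind hsum
  have hae := (mem_ae_iff_prob_eq_one (MeasurableSet.measurableSet_limsup hm)).2 hlim
  filter_upwards [hae] with ω hω R
  rw [Filter.mem_limsup_iff_frequently_mem] at hω
  obtain ⟨k, hk, hω⟩ := Filter.frequently_atTop.1 hω R.toNat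
  refine hasLowRing_of_blocks (ξ := (ξ · ω)) (η := (η · ω)) (M := scale k)
    (N := 192 * scale k ^ 2) (fun w => Set.mem_iInter.1 hω w) (R := R) ?_
  have := strictMono_scale.le_apply (x := k)
  omega

end IsFairSigns

end CornerPercolation

/-! ### Translation invariance and the tail of the diameter -/

namespace CornerPercolation

variable {Ω : Type*} [MeasurableSpace Ω] {μ : Measure Ω} {ξ η : ℤ → Ω → ℤˣ}

lemma step_neg (ξ : ℤ → ℤˣ) : step (-ξ) = -step ξ := by
  ext n
  simp [step]

lemma walk_neg (d : ℤ → ℤ) : walk (-d) = -walk d := by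
  ext n
  obtain ⟨n, rfl | rfl⟩ := n.eq_nat_or_neg
  · simp [walk_natCast]
  · simp [walk_neg_natCast]

/-- The component of `(k, 0)` contains a vertex that lies more than `n` to the left of it. -/
def ReachesLeft (G : SimpleGraph (ℤ × ℤ)) (n : ℕ) (k : ℤ) : Prop :=
  ∃ u, G.Reachable (k, 0) u ∧ u.1 < k - n

/-- The signs whose walk has the steps `d`. -/
def signsOf (d : ℤ → ℤ) (n : ℤ) : ℤˣ := if d n = -(n.negOnePow : ℤ) then 1 else -1

lemma signsOf_step (ξ : ℤ → ℤˣ) : signsOf (step ξ) = ξ := by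
  ext n
  rcases Int.units_eq_one_or (ξ n) with h | h <;>
    rcases Int.units_eq_one_or n.negOnePow with h' | h' <;> simp [signsOf, step, h, h']

lemma measurableSet_reachable {Z : Type*} [MeasurableSpace Z] {G : Z → SimpleGraph (ℤ × ℤ)}
    (hG : ∀ u v, MeasurableSet {z | (G z).Adj u v}) (u v : ℤ × ℤ) :
    MeasurableSet {z | (G z).Reachable u v} := by
  have key : ∀ n u, MeasurableSet {z | ∃ p : (G z).Walk u v, p.length = n} := by
    intro n
    induction n with
    | zero =>
      intro u
      have : {z | ∃ p : (G z).Walk u v, p.length = 0} = {_z | u = v} := by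
        ext z
        exact SimpleGraph.Walk.exists_length_eq_zero_iff
      rw [this]
      exact MeasurableSet.const _
    | succ n ih =>
      intro u
      have : {z | ∃ p : (G z).Walk u v, p.length = n + 1} =
          ⋃ w, {z | (G z).Adj u w} ∩ {z | ∃ p : (G z).Walk w v, p.length = n} := by
        ext z
        simp only [Set.mem_ofPred_eq, Set.mem_iUnion, Set.mem_inter_iff]
        constructor
        · rintro ⟨p, hp⟩
          cases p with
          | nil => simp at hp
          | cons hadj p => exact ⟨_, hadj, p, by simpa using hp⟩
        · rintro ⟨w, hadj, p, hp⟩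
          exact ⟨p.cons hadj, by simp [hp]⟩
      rw [this]
      exact MeasurableSet.iUnion fun w => (hG u w).inter (ih w)
  have : {z | (G z).Reachable u v} = ⋃ n, {z | ∃ p : (G z).Walk u v, p.length = n} := by
    ext z
    simp only [Set.mem_ofPred_eq, Set.mem_iUnion]
    exact ⟨fun ⟨p⟩ => ⟨_, p, rfl⟩, fun ⟨_, p, _⟩ => ⟨p⟩⟩
  rw [this]
  exact MeasurableSet.iUnion fun n => key n u

/-- The corner percolation graph as a function of the steps of its two walks. -/
def codedGraph (c : ℤ ⊕ ℤ → ℤ) : SimpleGraph (ℤ × ℤ) :=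
  graph (signsOf (c ∘ Sum.inl)) (signsOf (c ∘ Sum.inr))

lemma codedGraph_jointSteps (ξ η : ℤ → ℤˣ) : codedGraph (jointSteps ξ η) = graph ξ η := by
  rw [codedGraph, jointSteps, Sum.elim_comp_inl, Sum.elim_comp_inr, signsOf_step, signsOf_step]

lemma measurableSet_codedGraph_adj (u v : ℤ × ℤ) : MeasurableSet {c | (codedGraph c).Adj u v} := by
  let f : (ℤ ⊕ ℤ → ℤ) → ℤ × ℤ × ℤ × ℤ :=
    fun c => (c (Sum.inl u.1), c (Sum.inl v.1), c (Sum.inr u.2), c (Sum.inr v.2))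
  have hf : Measurable f := by fun_prop
  let g : ℤ → ℤ → ℤˣ := fun n z => if z = -(n.negOnePow : ℤ) then 1 else -1
  let P : ℤ → ℤ → (ℤ × ℤ) → (ℤ × ℤ) → Prop := fun a b u v =>
    (v = (u.1, u.2 + 1) ∧ ((g u.1 a = 1 ∧ Even u.2) ∨ (g u.1 a = -1 ∧ Odd u.2))) ∨
    (v = (u.1 + 1, u.2) ∧ ((g u.2 b = 1 ∧ Even u.1) ∨ (g u.2 b = -1 ∧ Odd u.1)))
  have : {c | (codedGraph c).Adj u v} =
      f ⁻¹' {q | u ≠ v ∧ (P q.1 q.2.2.1 u v ∨ P q.2.1 q.2.2.2 v u)} := by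
    ext c
    simp only [codedGraph, graph, SimpleGraph.fromRel_adj]
    rfl
  rw [this]
  exact hf (MeasurableSet.of_discrete)

lemma measurableSet_reachesLeft (n : ℕ) (k : ℤ) :
    MeasurableSet {c | ReachesLeft (codedGraph c) n k} := by
  have : {c | ReachesLeft (codedGraph c) n k} =
      ⋃ u : ℤ × ℤ, {c | (codedGraph c).Reachable (k, 0) u} ∩ {_c | u.1 < k - n} := by
    ext c
    simp [ReachesLeft]
  rw [this]
  exact MeasurableSet.iUnion fun u =>
    (measurableSet_reachable measurableSet_codedGraph_adj _ _).inter (MeasurableSet.const _)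

/-- Translation by `(k, 0)` is an isomorphism between corner percolation graphs.  It exchanges odd and
even edges on the horizontal lines if `k` is odd, hence the sign. -/
def shiftIso (ξ η : ℤ → ℤˣ) (k : ℤ) :
    graph (fun n => ξ (n + k)) (fun m => k.negOnePow * η m) ≃g graph ξ η where
  toEquiv := Equiv.addRight (k, 0)
  map_rel_iff' := by
    have h1 : (1 : ℤˣ) ≠ -1 := by decide
    have h2 : (-1 : ℤˣ) ≠ 1 := by decide
    have key : ∀ (m a : ℤ), (η m = 1 ∧ Even (a + k) ∨ η m = -1 ∧ Odd (a + k)) ↔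
        (k.negOnePow * η m = 1 ∧ Even a ∨ k.negOnePow * η m = -1 ∧ Odd a) := by
      intro m a
      rcases Int.even_or_odd k with hk | hk <;> rcases Int.units_eq_one_or (η m) with h | h <;>
        simp [h, h1, h2, hk, Int.negOnePow_even, Int.negOnePow_odd, Int.even_add,
          ← Int.not_even_iff_odd] <;> simp_all [← Int.not_even_iff_odd]
    rintro ⟨a, b⟩ ⟨c, d⟩
    simp only [graph, SimpleGraph.fromRel_adj, Equiv.coe_addRight, Prod.mk_add_mk, add_zero, key,
      Prod.mk.injEq, ne_eq, add_left_inj, add_right_comm _ k 1]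

lemma reachesLeft_iff (ξ η : ℤ → ℤˣ) (n : ℕ) (k : ℤ) : ReachesLeft (graph ξ η) n k ↔
    ReachesLeft (graph (fun n => ξ (n + k)) (fun m => k.negOnePow * η m)) n 0 := by
  have hiso : ∀ u, (graph ξ η).Reachable (k, 0) (u + (k, 0)) ↔
      (graph (fun n => ξ (n + k)) (fun m => k.negOnePow * η m)).Reachable (0, 0) u := by
    intro u
    rw [← (shiftIso ξ η k).reachable_iff]
    simp [shiftIso]
  constructor
  · rintro ⟨u, hu, hlt⟩
    refine ⟨u - (k, 0), ?_, ?_⟩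
    · rwa [← hiso, sub_add_cancel]
    · simp only [Prod.fst_sub]
      omega
  · rintro ⟨u, hu, hlt⟩
    refine ⟨u + (k, 0), (hiso u).2 hu, ?_⟩
    simp only [Prod.fst_add]
    omega

namespace IsFairSigns

lemma measurableSet_setOf_reachesLeft (h : IsFairSigns μ ξ η) (n : ℕ) (k : ℤ) :
    MeasurableSet {ω | ReachesLeft (graph (ξ · ω) (η · ω)) n k} := by
  have := (measurable_pi_iff.2 h.isFair_jointSteps.measurable) (measurableSet_reachesLeft n k)
  simpa only [Set.preimage_ofPred_eq, codedGraph_jointSteps] using this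

variable [IsProbabilityMeasure μ]

/-- Translation invariance along the first axis. -/
lemma measure_reachesLeft (h : IsFairSigns μ ξ η) (n : ℕ) (k : ℤ) :
    μ {ω | ReachesLeft (graph (ξ · ω) (η · ω)) n k} =
      μ {ω | ReachesLeft (graph (ξ · ω) (η · ω)) n 0} := by
  have h' := h.transform k 1 k.negOnePow
  have := h'.isFair_jointSteps.measure_eq h.isFair_jointSteps (measurableSet_reachesLeft n 0)
  simp only [Set.mem_ofPred_eq, codedGraph_jointSteps, one_mul] at this
  rw [← this]
  simp_rw [reachesLeft_iff _ _ n k]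

lemma measure_iInter_arm (h : IsFairSigns μ ξ η) {A : Bool × Bool → Set (ℕ → ℤ)}
    (hA : ∀ w, MeasurableSet (A w)) :
    μ (⋂ w, {ω | arm (ξ · ω) (η · ω) w ∈ A w}) =
      ∏ w, μ {ω | arm (ξ · ω) (η · ω) w ∈ A w} := by
  have hind := iIndepFun_curry (μ := μ) (κ := fun _ : Bool × Bool => ℕ)
    (s := fun w j ω => arm (ξ · ω) (η · ω) w j) (fun w j => h.isFair_arm.measurable (w, j))
    (h.isFair_arm.indep.precomp (g := fun p : Σ _ : Bool × Bool, ℕ => (p.1, p.2))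
      (by rintro ⟨a, b⟩ ⟨c, d⟩ hh; simpa using hh))
  have := hind.measure_inter_preimage_eq_mul Finset.univ (sets := A) fun w _ => hA w
  simp only [Finset.mem_univ, Set.iInter_true] at this
  exact this

/-- With probability at least `8⁻⁴`, at least `g` of the vertices `(k, 0)` with `0 < k ≤ 192 * g ^ 2`
lie in long contours; the expected number of such vertices is `192 * g ^ 2` times the probability
for the origin. -/
lemma le_mul_measure_reachesLeft (h : IsFairSigns μ ξ η) {g n : ℕ} (hg : 0 < g)
    (hn : 4 * n ≤ g ^ 2) :
    g * (1 / 8 : ℝ) ^ 4 ≤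
      (192 * g ^ 2 : ℕ) * μ.real {ω | ReachesLeft (graph (ξ · ω) (η · ω)) n 0} := by
  classical
  let N := 192 * g ^ 2
  let A : Set (ℕ → ℤ) := {t | HitsBefore (6 * g) (2 * g) N 0 t ∧ ¬ Exits (2 * g) n 0 t}
  have hA : MeasurableSet A := (measurableSet_hitsBefore _ _ _ _).inter (measurableSet_exits _ _ _).compl
  let E : Set Ω := ⋂ w, {ω | arm (ξ · ω) (η · ω) w ∈ A}
  have hEm : MeasurableSet E := MeasurableSet.iInter fun w =>
    (measurable_pi_iff.2 fun j => h.isFair_arm.measurable (w, j)) hA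
  have hE : (1 / 8 : ℝ) ^ 4 ≤ μ.real E := by
    rw [measureReal_def, h.measure_iInter_arm fun _ => hA, ENNReal.toReal_prod]
    calc (1 / 8 : ℝ) ^ 4 = ∏ _w : Bool × Bool, 1 / 8 := by simp
      _ ≤ _ := Finset.prod_le_prod (fun _ _ => by norm_num) fun w _ =>
        le_prob_hitsBefore_not_exits (h.isFair_arm.precomp (e := fun j => (w, j))
          fun j k hjk => by simpa using hjk) hg hn
  let L : ℤ → Set Ω := fun k => {ω | ReachesLeft (graph (ξ · ω) (η · ω)) n k}
  have hLm : ∀ k, MeasurableSet (L k) := h.measurableSet_setOf_reachesLeft n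
  have hcount : ∀ ω, E.indicator (fun _ => (g : ℝ)) ω ≤
      ∑ k ∈ Finset.Ioc (0 : ℤ) N, (L k).indicator (fun _ => (1 : ℝ)) ω := by
    intro ω
    by_cases hω : ω ∈ E
    · rw [Set.indicator_of_mem hω]
      have hω' := Set.mem_iInter.1 hω
      have := le_card_long_of_arms (ξ := (ξ · ω)) (η := (η · ω)) (g := g) (n := n) (N := N)
        (fun w => (hω' w).1) fun k hk => by
          by_contra hc
          exact (hω' (true, true)).2 ⟨k, hk, by rw [zero_add]; omega⟩
      calc (g : ℝ) ≤ _ := Nat.cast_le.2 this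
        _ = _ := by
          rw [Finset.card_filter, Nat.cast_sum]
          refine Finset.sum_congr rfl fun k _ => ?_
          simp only [Set.indicator_apply, L, ReachesLeft, Set.mem_ofPred_eq]
          split_ifs <;> simp
    · rw [Set.indicator_of_notMem hω]
      exact Finset.sum_nonneg fun k _ => Set.indicator_nonneg (fun _ _ => zero_le_one) _
  have hint := integral_mono (μ := μ) ((integrable_const (g : ℝ)).indicator hEm)
    (integrable_finsetSum _ fun k _ => (integrable_const (1 : ℝ)).indicator (hLm k)) hcount
  rw [integral_finsetSum _ fun k _ => (integrable_const (1 : ℝ)).indicator (hLm k),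
    integral_indicator_const _ hEm] at hint
  simp_rw [integral_indicator_const _ (hLm _)] at hint
  have hL : ∀ k, μ.real (L k) = μ.real (L 0) := fun k => by
    rw [measureReal_def, measureReal_def]
    exact congrArg _ (h.measure_reachesLeft n k)
  simp only [hL, smul_eq_mul, mul_one, Finset.sum_const, Int.card_Ioc, nsmul_eq_mul] at hint
  simp only [sub_zero, Int.toNat_natCast] at hint
  have hg' : (0 : ℝ) ≤ g := g.cast_nonneg
  calc g * (1 / 8 : ℝ) ^ 4 ≤ g * μ.real E := mul_le_mul_of_nonneg_left hE hg'
    _ ≤ _ := by rw [mul_comm]; exact hint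

lemma le_prob_reachesLeft (h : IsFairSigns μ ξ η) {n : ℕ} (hn : 1 ≤ n) :
    (1 / 3145728 : ℝ) * (n : ℝ) ^ (-(1 / 2) : ℝ) ≤
      μ.real {ω | ReachesLeft (graph (ξ · ω) (η · ω)) n 0} := by
  set p := μ.real {ω | ReachesLeft (graph (ξ · ω) (η · ω)) n 0}
  have hn' : (1 : ℝ) ≤ n := by exact_mod_cast hn
  -- `g` is of order `√n`, as small as the condition `4 * n ≤ g ^ 2` allows
  obtain ⟨g, hg⟩ : ∃ g, g = 2 * (Nat.sqrt n + 1) := ⟨_, rfl⟩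
  have h1 := h.le_mul_measure_reachesLeft (g := g) (n := n) (by omega) (by
    have := Nat.lt_succ_sqrt' n
    rw [Nat.succ_eq_add_one] at this
    rw [hg, mul_pow]
    omega)
  have hg0 : (0 : ℝ) < g := by
    have : 0 < g := by omega
    exact_mod_cast this
  have hgn : (g : ℝ) ≤ 4 * √n := by
    have h2 := Real.nat_sqrt_le_real_sqrt (a := n)
    have h3 : (1 : ℝ) ≤ √n := by rwa [Real.one_le_sqrt]
    rw [hg]
    push_cast
    linarith
  have h4 : (1 / 8 : ℝ) ^ 4 ≤ 192 * g * p := by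
    push_cast at h1
    refine le_of_mul_le_mul_left (a := (g : ℝ)) ?_ hg0
    linarith
  have hp : 0 ≤ p := measureReal_nonneg
  have hs : 0 < √(n : ℝ) := Real.sqrt_pos.2 (by linarith)
  rw [Real.rpow_neg (by linarith), ← Real.sqrt_eq_rpow, ← div_eq_mul_inv, div_le_iff₀ hs]
  nlinarith [mul_le_mul_of_nonneg_right hgn hp]

/-- Markov's inequality, read backwards: the expectation is at least `n` times a probability of order
at least `n ^ (-1/2)`. -/
lemma lintegral_originDiam (h : IsFairSigns μ ξ η) :
    ∫⁻ ω, originDiam (ξ · ω) (η · ω) ∂μ = ∞ := by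
  refine ENNReal.eq_top_of_forall_nnreal_le fun r => ?_
  obtain ⟨n, hn⟩ := exists_nat_ge ((3145728 * (r : ℝ)) ^ 2 + 1)
  have hn1 : 1 ≤ n := by
    have : (1 : ℝ) ≤ n := by nlinarith [sq_nonneg (3145728 * (r : ℝ))]
    exact_mod_cast this
  have hn0 : (0 : ℝ) < n := by exact_mod_cast hn1
  let L : Set Ω := {ω | ReachesLeft (graph (ξ · ω) (η · ω)) n 0}
  have hL : (r : ℝ) ≤ n * μ.real L := by
    have h1 := mul_le_mul_of_nonneg_left (h.le_prob_reachesLeft hn1) hn0.le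
    have h2 : (n : ℝ) * (n : ℝ) ^ (-(1 / 2) : ℝ) = √n := by
      rw [Real.sqrt_eq_rpow]
      nth_rewrite 1 [← Real.rpow_one (n : ℝ)]
      rw [← Real.rpow_add hn0]
      norm_num
    have h3 : 3145728 * (r : ℝ) ≤ √n := Real.le_sqrt_of_sq_le (by linarith)
    rw [mul_left_comm, h2] at h1
    linarith
  calc (r : ℝ≥0∞) = ENNReal.ofReal r := (ENNReal.ofReal_coe_nnreal).symm
    _ ≤ ENNReal.ofReal (n * μ.real L) := ENNReal.ofReal_le_ofReal hL
    _ = n * μ L := by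
      rw [ENNReal.ofReal_mul hn0.le, ENNReal.ofReal_natCast, ofReal_measureReal]
    _ = ∫⁻ ω, L.indicator (fun _ => (n : ℝ≥0∞)) ω ∂μ :=
      (lintegral_indicator_const (h.measurableSet_setOf_reachesLeft n 0) _).symm
    _ ≤ _ := by
      refine lintegral_mono fun ω => ?_
      by_cases hω : ω ∈ L
      · obtain ⟨u, hu, hlt⟩ := id hω
        rw [Set.indicator_of_mem hω]
        exact (lt_originDiam hu (by simpa using hlt)).le
      · rw [Set.indicator_of_notMem hω]
        exact zero_le

end IsFairSigns

end CornerPercolation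

theorem theorem1p1 :
    ∃ c : ℝ, 0 < c ∧
      ∀ (Ω : Type*) [MeasurableSpace Ω] (μ : Measure Ω) [IsProbabilityMeasure μ]
        (ξ η : ℤ → Ω → ℤˣ), CornerPercolation.IsFairSigns μ ξ η →
        -- almost surely, there are no infinite components
        (∀ᵐ ω ∂μ, ∀ C : (CornerPercolation.graph (ξ · ω) (η · ω)).ConnectedComponent,
          C.supp.Finite) ∧
        -- almost surely, every vertex is enclosed by infinitely many cycles of each level
        (∀ᵐ ω ∂μ, ∀ (v : ℤ × ℤ) (l : ℤ),
          {C : (CornerPercolation.graph (ξ · ω) (η · ω)).ConnectedComponent |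
            CornerPercolation.IsCycle C ∧ CornerPercolation.Encloses C v ∧
              CornerPercolation.HasLevel C l}.Infinite) ∧
        -- the tail bound for the diameter of the cycle of the origin
        (∀ n : ℕ, 1 ≤ n →
          c * (n : ℝ) ^ (-(1 / 2) : ℝ) ≤
            μ.real {ω | (n : ℝ≥0∞) < CornerPercolation.originDiam (ξ · ω) (η · ω)}) ∧
        -- the expected diameter of the cycle of the origin is infinite
        ∫⁻ ω, CornerPercolation.originDiam (ξ · ω) (η · ω) ∂μ = ∞ := by
  refine ⟨1 / 3145728, by norm_num, fun Ω _ μ _ ξ η h => ⟨?_, ?_, fun n hn => ?_, ?_⟩⟩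
  · filter_upwards [h.ae_hasLowRing] with ω hω
    exact (CornerPercolation.encodes_graph _ _).finite_supp hω
  -- the reflected signs have the walks `-X` and `-Y`, whose low rings are the high rings of `X + Y`
  · filter_upwards [h.ae_hasLowRing, (h.transform 0 (-1) (-1)).ae_hasLowRing] with ω hω hω'
    refine (CornerPercolation.encodes_graph _ _).infinite_cycles hω fun R => ?_
    have e : ∀ ξ : ℤ → Ω → ℤˣ, (fun n => -1 * ξ n ω) = -fun n => ξ n ω := fun ξ => by
      ext n
      simp
    have := hω' R
    simp only [add_zero, e, CornerPercolation.step_neg, CornerPercolation.walk_neg] at this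
    exact this
  · refine (h.le_prob_reachesLeft hn).trans (measureReal_mono ?_)
    rintro ω ⟨u, hu, hlt⟩
    exact CornerPercolation.lt_originDiam hu (by simpa using hlt)
  · exact h.lintegral_originDiam
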